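/- Let $M(\phi,\xi,\eta,g_M)$ be a cosymplectic manifold of dimension $2m+1$, that is, a smooth Riemannian manifold with a smooth $(1,1)$-tensor field $\phi$, a smooth vector field $\xi$ and a smooth $1$-form $\eta$ satisfying $\phi^2=-I+\eta\otimes\xi$, $\phi\xi=0$, $\eta\circ\phi=0$, $\eta(\xi)=1$, $g_M(\phi X,\phi Y)=g_M(X,Y)-\eta(X)\eta(Y)$ and $\eta(X)=g_M(X,\xi)$, which is normal ($[\phi,\phi]+2\,d\eta\otimes\xi=0$, where $2\,d\eta(X,Y)=X\eta(Y)-Y\eta(X)-\eta([X,Y])$) and for which $\eta$ and the $2$-form $\Phi(X,Y)=g_M(X,\phi Y)$ are closed. Let $(N,g_N)$ be a Riemannian manifold and let $F:M\to N$ be an anti-invariant Riemannian submersion: a smooth surjective map of maximal rank (its differential $F_*$ is surjective at every point) such that $F_*$ preserves the lengths of the horizontal vectors, i.e. of the vectors in $(\ker F_*)^\perp$, and such that $\phi(\ker F_*)\subseteq(\ker F_*)^\perp$. Assume moreover that $\phi(\ker F_*)=(\ker F_*)^\perp$. Let $\nabla$ be the Levi-Civita connection of $g_M$, let $\mathcal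 V$ and $\mathcal H$ be the orthogonal projections onto $\ker F_*$ and $(\ker F_*)^\perp$, and let $$\mathcal T_{E_1}E_2=\mathcal H\nabla_{\mathcal VE_1}\mathcal VE_2+\mathcal V\nabla_{\mathcal VE_1}\mathcal HE_2,\qquad \mathcal A_{E_1}E_2=\mathcal V\nabla_{\mathcal HE_1}\mathcal HE_2+\mathcal H\nabla_{\mathcal HE_1}\mathcal VE_2$$ be O'Neill's tensors. Then the following two assertions are equivalent. (1) $M$ is locally a Riemannian product of leaves of $\ker F_*$ and $(\ker F_*)^\perp$: every point of $M$ has an open neighbourhood that is isometric to a Riemannian product $(U_1,g_1)\times(U_2,g_2)$ of connected Riemannian manifolds, by a diffeomorphism that carries the tangent spaces of the first factor to $\ker F_*$ and those of the second factor to $(\ker F_*)^\perp$. (2) $\mathcal A_X\phi Y=0$ for all smooth horizontal vector fields $X,Y$ on $M$, and $\mathcal T_V\phi W=0$ for all smooth vertical vector fields $V,W$ on $M$. -/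

import Mathlib

open Bundle Manifold
open scoped ContDiff

noncomputable section

namespace RiemGeom

section LeviCivita

variable {E : Type*} [NormedAddCommGroup E] [NormedSpace ℝ E] [FiniteDimensional ℝ E]
  {M : Type*} [TopologicalSpace M] [ChartedSpace E M] [IsManifold 𝓘(ℝ, E) ∞ M]
  [RiemannianBundle (fun x : M => TangentSpace 𝓘(ℝ, E) x)]
  [IsContMDiffRiemannianBundle 𝓘(ℝ, E) ∞ E (fun x : M => TangentSpace 𝓘(ℝ, E) x)]

/-- The right-hand side of the Koszul formula for `g(∇_X Y, Z)`:
`½ (X g(Y,Z) + Y g(X,Z) - Z g(X,Y) + g([X,Y],Z) - g([X,Z],Y) - g([Y,Z],X))`. -/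
def koszul (Y X Z : Π x : M, TangentSpace 𝓘(ℝ, E) x) (x : M) : ℝ :=
  (1 / 2) *
    (mvfderiv 𝓘(ℝ, E) (fun y => inner ℝ (Y y) (Z y)) x (X x)
      + mvfderiv 𝓘(ℝ, E) (fun y => inner ℝ (X y) (Z y)) x (Y x)
      - mvfderiv 𝓘(ℝ, E) (fun y => inner ℝ (X y) (Y y)) x (Z x)
      + inner ℝ (VectorField.mlieBracket 𝓘(ℝ, E) X Y x) (Z x)
      - inner ℝ (VectorField.mlieBracket 𝓘(ℝ, E) X Z x) (Y x)
      - inner ℝ (VectorField.mlieBracket 𝓘(ℝ, E) Y Z x) (X x))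

variable {X X' Y Y' Z : Π x : M, TangentSpace 𝓘(ℝ, E) x} {x : M}

set_option linter.unusedSectionVars false in
theorem mdiffAt_inner (hX : MDiffAt (T% X) x) (hY : MDiffAt (T% Y) x) :
    MDiffAt (fun y => (inner ℝ (X y) (Y y) : ℝ)) x :=
  MDifferentiableAt.inner_bundle (F := E) (E := fun x : M => TangentSpace 𝓘(ℝ, E) x)
    (b := fun y : M => y) hX hY

theorem koszul_tensorial₁ (hY : MDiffAt (T% Y) x) (hZ : MDiffAt (T% Z) x) :
    TensorialAt 𝓘(ℝ, E) E (fun X => koszul Y X Z x) x where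
  smul {f X} hf hX := by
    have h1 := VectorField.mlieBracket_smul_left (W := Y) hf hX
    have h2 := VectorField.mlieBracket_smul_left (W := Z) hf hX
    simp only [koszul, h1, h2, Pi.smul_apply', inner_smul_left, inner_smul_right,
      RCLike.conj_to_real, mvfderiv_fun_mul hf (mdiffAt_inner hX hZ),
      mvfderiv_fun_mul hf (mdiffAt_inner hX hY), inner_add_left, map_smul, smul_eq_mul,
      add_apply, smul_apply, neg_smul, inner_neg_left]
    ring
  add {X X'} hX hX' := by
    have h1 := VectorField.mlieBracket_add_left (W := Y) hX hX'
    have h2 := VectorField.mlieBracket_add_left (W := Z) hX hX'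
    simp only [koszul, h1, h2, Pi.add_apply, inner_add_left, inner_add_right,
      mvfderiv_fun_add (mdiffAt_inner hX hZ) (mdiffAt_inner hX' hZ),
      mvfderiv_fun_add (mdiffAt_inner hX hY) (mdiffAt_inner hX' hY), map_add,
      add_apply]
    ring

theorem koszul_tensorial₂ (hY : MDiffAt (T% Y) x) (hX : MDiffAt (T% X) x) :
    TensorialAt 𝓘(ℝ, E) E (fun Z => koszul Y X Z x) x where
  smul {f Z} hf hZ := by
    have h1 := VectorField.mlieBracket_smul_right (V := X) hf hZ
    have h2 := VectorField.mlieBracket_smul_right (V := Y) hf hZ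
    simp only [koszul, h1, h2, Pi.smul_apply', inner_smul_left, inner_smul_right,
      RCLike.conj_to_real, mvfderiv_fun_mul hf (mdiffAt_inner hY hZ),
      mvfderiv_fun_mul hf (mdiffAt_inner hX hZ), inner_add_left, map_smul, smul_eq_mul,
      add_apply, smul_apply,
      real_inner_comm (X x) (Z x), real_inner_comm (Y x) (Z x)]
    ring
  add {Z Z'} hZ hZ' := by
    have h1 := VectorField.mlieBracket_add_right (V := X) hZ hZ'
    have h2 := VectorField.mlieBracket_add_right (V := Y) hZ hZ'
    simp only [koszul, h1, h2, Pi.add_apply, inner_add_left, inner_add_right,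
      mvfderiv_fun_add (mdiffAt_inner hY hZ) (mdiffAt_inner hY hZ'),
      mvfderiv_fun_add (mdiffAt_inner hX hZ) (mdiffAt_inner hX hZ'), map_add,
      add_apply]
    ring


open Classical in
/-- The endomorphism `X ↦ ∇_X Y` of the tangent space at `x`, determined by the Koszul formula for
every vector field `Y` that is differentiable at `x` (and given the junk value `0` otherwise). -/
def leviCivitaFun (Y : Π x : M, TangentSpace 𝓘(ℝ, E) x) (x : M) :
    TangentSpace 𝓘(ℝ, E) x →L[ℝ] TangentSpace 𝓘(ℝ, E) x :=
  haveI : FiniteDimensional ℝ (TangentSpace 𝓘(ℝ, E) x) := inferInstanceAs (FiniteDimensional ℝ E)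
  haveI : CompleteSpace (TangentSpace 𝓘(ℝ, E) x) := FiniteDimensional.complete ℝ _
  if hY : MDiffAt (T% Y) x then
    LinearMap.toContinuousLinearMap
      { toFun := fun v => (InnerProductSpace.toDual ℝ (TangentSpace 𝓘(ℝ, E) x)).symm
          (TensorialAt.mkHom₂ (fun X Z => koszul Y X Z x) x
            (fun _ hZ => koszul_tensorial₁ hY hZ) (fun _ hX => koszul_tensorial₂ hY hX) v)
        map_add' := fun v w => by simp only [map_add]
        map_smul' := fun c v => by simp }
  else 0

theorem inner_leviCivitaFun (hX : MDiffAt (T% X) x) (hY : MDiffAt (T% Y) x)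
    (hZ : MDiffAt (T% Z) x) :
    inner ℝ (leviCivitaFun Y x (X x)) (Z x) = koszul Y X Z x := by
  have : FiniteDimensional ℝ (TangentSpace 𝓘(ℝ, E) x) := inferInstanceAs (FiniteDimensional ℝ E)
  have : CompleteSpace (TangentSpace 𝓘(ℝ, E) x) := FiniteDimensional.complete ℝ _
  have key := TensorialAt.mkHom₂_apply (Φ := fun X Z => koszul Y X Z x) (I := 𝓘(ℝ, E))
    (F := E) (F' := E) (fun _ hZ => koszul_tensorial₁ hY hZ)
    (fun _ hX => koszul_tensorial₂ hY hX) hX hZ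
  rw [leviCivitaFun, dif_pos hY, ← key]
  exact InnerProductSpace.toDual_symm_apply

set_option linter.unusedSectionVars false in
theorem clm_ext_extend {A B : TangentSpace 𝓘(ℝ, E) x →L[ℝ] TangentSpace 𝓘(ℝ, E) x}
    (h : ∀ X Z : Π x : M, TangentSpace 𝓘(ℝ, E) x, MDiffAt (T% X) x → MDiffAt (T% Z) x →
      inner ℝ (A (X x)) (Z x) = inner ℝ (B (X x)) (Z x)) : A = B := by
  ext v
  refine ext_inner_right ℝ fun w => ?_
  have := h (FiberBundle.extend E v) (FiberBundle.extend E w)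
    (FiberBundle.mdifferentiableAt_extend ..) (FiberBundle.mdifferentiableAt_extend ..)
  simpa using this

variable (E M) in
/-- The Levi-Civita connection of a Riemannian manifold. In Mathlib's argument order
`leviCivita E M Y x (X x)` is `(∇_X Y)(x)`. It is torsion free and metric, see
`leviCivita_torsion` and `leviCivita_metric`. -/
def leviCivita : CovariantDerivative 𝓘(ℝ, E) E (fun x : M => TangentSpace 𝓘(ℝ, E) x) where
  toFun := leviCivitaFun
  isCovariantDerivativeOnUniv :=
    { add := by
        intro Y Y' x hY hY' _
        refine clm_ext_extend fun X Z hX hZ => ?_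
        have hs : MDiffAt (T% (Y + Y')) x := mdifferentiableAt_add_section hY hY'
        have h1 := VectorField.mlieBracket_add_right (V := X) hY hY'
        have h2 := VectorField.mlieBracket_add_left (W := Z) hY hY'
        simp only [add_apply, inner_add_left, inner_leviCivitaFun hX hs hZ,
          inner_leviCivitaFun hX hY hZ, inner_leviCivitaFun hX hY' hZ]
        simp only [koszul, h1, h2, Pi.add_apply, inner_add_left, inner_add_right,
          mvfderiv_fun_add (mdiffAt_inner hX hY) (mdiffAt_inner hX hY'),
          mvfderiv_fun_add (mdiffAt_inner hY hZ) (mdiffAt_inner hY' hZ), map_add,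
          add_apply]
        ring
      leibniz := by
        intro Y f x hY hf _
        refine clm_ext_extend fun X Z hX hZ => ?_
        have hs : MDiffAt (T% (f • Y)) x := hf.smul_section hY
        have h1 := VectorField.mlieBracket_smul_right (V := X) hf hY
        have h2 := VectorField.mlieBracket_smul_left (W := Z) hf hY
        simp only [add_apply, smul_apply, inner_add_left, inner_smul_left, RCLike.conj_to_real,
          ContinuousLinearMap.smulRight_apply,
          inner_leviCivitaFun hX hs hZ, inner_leviCivitaFun hX hY hZ]
        simp only [koszul, h1, h2, Pi.smul_apply', inner_smul_left, inner_smul_right,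
          RCLike.conj_to_real, mvfderiv_fun_mul hf (mdiffAt_inner hX hY),
          mvfderiv_fun_mul hf (mdiffAt_inner hY hZ), inner_add_left, map_smul, smul_eq_mul,
          add_apply, smul_apply, neg_smul, inner_neg_left,
          real_inner_comm (X x) (Y x)]
        ring }

theorem inner_leviCivita (hX : MDiffAt (T% X) x) (hY : MDiffAt (T% Y) x)
    (hZ : MDiffAt (T% Z) x) :
    inner ℝ (leviCivita E M Y x (X x)) (Z x) = koszul Y X Z x :=
  inner_leviCivitaFun hX hY hZ

/-- `∇_X Y - ∇_Y X = [X, Y]`. -/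
theorem leviCivita_torsion : (leviCivita E M).torsion = 0 := by
  rw [CovariantDerivative.torsion_eq_zero_iff]
  intro X Y x hX hY
  refine ext_inner_right ℝ fun w => ?_
  have hZ : MDiffAt (T% (FiberBundle.extend E w)) x := FiberBundle.mdifferentiableAt_extend ..
  have hw : w = FiberBundle.extend E w x := by simp
  rw [hw, inner_sub_left, inner_leviCivita hX hY hZ, inner_leviCivita hY hX hZ]
  have h := VectorField.mlieBracket_swap_apply (I := 𝓘(ℝ, E)) (V := Y) (W := X) (x := x)
  simp only [koszul, h, inner_neg_left, real_inner_comm (Y _) (X _)]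
  ring

/-- `X g(Y, Z) = g(∇_X Y, Z) + g(Y, ∇_X Z)`. -/
theorem leviCivita_metric (hX : MDiffAt (T% X) x) (hY : MDiffAt (T% Y) x)
    (hZ : MDiffAt (T% Z) x) :
    mvfderiv 𝓘(ℝ, E) (fun y => inner ℝ (Y y) (Z y)) x (X x)
      = inner ℝ (leviCivita E M Y x (X x)) (Z x) + inner ℝ (Y x) (leviCivita E M Z x (X x)) := by
  have h1 := inner_leviCivita hX hY hZ
  have h2 := inner_leviCivita hX hZ hY
  rw [real_inner_comm] at h2
  have h := VectorField.mlieBracket_swap_apply (I := 𝓘(ℝ, E)) (V := Z) (W := Y) (x := x)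
  rw [h1, h2]
  simp only [koszul, h, inner_neg_left, real_inner_comm (Y _) (Z _)]
  ring

end LeviCivita

section AlmostContact

variable {E : Type*} [NormedAddCommGroup E] [NormedSpace ℝ E]
  {M : Type*} [TopologicalSpace M] [ChartedSpace E M] [IsManifold 𝓘(ℝ, E) ∞ M]

/-- `X` is a smooth vector field. -/
def IsSmoothField (X : Π x : M, TangentSpace 𝓘(ℝ, E) x) : Prop :=
  ContMDiff 𝓘(ℝ, E) (𝓘(ℝ, E).prod 𝓘(ℝ, E)) ∞ (T% X)

variable (E M) in
/-- An almost contact structure `(φ, ξ, η)` on `M`: a smooth tensor field `φ` of type `(1,1)`,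
a smooth vector field `ξ` and a smooth one-form `η`. -/
structure AlmostContactStructure where
  φ : Π x : M, TangentSpace 𝓘(ℝ, E) x →L[ℝ] TangentSpace 𝓘(ℝ, E) x
  ξ : Π x : M, TangentSpace 𝓘(ℝ, E) x
  η : Π x : M, TangentSpace 𝓘(ℝ, E) x →L[ℝ] ℝ
  smooth_φ : ContMDiff 𝓘(ℝ, E) (𝓘(ℝ, E).prod 𝓘(ℝ, E →L[ℝ] E)) ∞
    (fun x => TotalSpace.mk' (E →L[ℝ] E)
      (E := fun x : M => TangentSpace 𝓘(ℝ, E) x →L[ℝ] TangentSpace 𝓘(ℝ, E) x) x (φ x))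
  smooth_ξ : IsSmoothField ξ
  smooth_η : ContMDiff 𝓘(ℝ, E) (𝓘(ℝ, E).prod 𝓘(ℝ, E →L[ℝ] ℝ)) ∞
    (fun x => TotalSpace.mk' (E →L[ℝ] ℝ)
      (E := fun x : M => TangentSpace 𝓘(ℝ, E) x →L[ℝ] Bundle.Trivial M ℝ x) x (η x))
  φ_φ : ∀ x v, φ x (φ x v) = -v + η x v • ξ x
  φ_ξ : ∀ x, φ x (ξ x) = 0
  η_φ : ∀ x v, η x (φ x v) = 0
  η_ξ : ∀ x, η x (ξ x) = 1

/-- The vector field `φ X`, for a tensor field `φ` of type `(1,1)`. -/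
def applyField (φ : Π x : M, TangentSpace 𝓘(ℝ, E) x →L[ℝ] TangentSpace 𝓘(ℝ, E) x)
    (X : Π x : M, TangentSpace 𝓘(ℝ, E) x) : Π x : M, TangentSpace 𝓘(ℝ, E) x :=
  fun x => φ x (X x)

/-- The Nijenhuis tensor
`[φ, φ](X, Y) = φ²[X, Y] + [φX, φY] - φ[φX, Y] - φ[X, φY]`. -/
def nijenhuis (φ : Π x : M, TangentSpace 𝓘(ℝ, E) x →L[ℝ] TangentSpace 𝓘(ℝ, E) x)
    (X Y : Π x : M, TangentSpace 𝓘(ℝ, E) x) (x : M) : TangentSpace 𝓘(ℝ, E) x :=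
  φ x (φ x (VectorField.mlieBracket 𝓘(ℝ, E) X Y x))
    + VectorField.mlieBracket 𝓘(ℝ, E) (applyField φ X) (applyField φ Y) x
    - φ x (VectorField.mlieBracket 𝓘(ℝ, E) (applyField φ X) Y x)
    - φ x (VectorField.mlieBracket 𝓘(ℝ, E) X (applyField φ Y) x)

/-- The exterior derivative of a one-form, `X η(Y) - Y η(X) - η([X, Y])`
(this is `2 dη(X, Y)` for authors who put a factor `1/2` into `d`). -/
def extDerivOneForm (η : Π x : M, TangentSpace 𝓘(ℝ, E) x →L[ℝ] ℝ)
    (X Y : Π x : M, TangentSpace 𝓘(ℝ, E) x) (x : M) : ℝ :=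
  mvfderiv 𝓘(ℝ, E) (fun y => η y (Y y)) x (X x)
    - mvfderiv 𝓘(ℝ, E) (fun y => η y (X y)) x (Y x)
    - η x (VectorField.mlieBracket 𝓘(ℝ, E) X Y x)

/-- The exterior derivative of a two-form `Φ`, given as a function of two vector fields:
`X Φ(Y, Z) + Y Φ(Z, X) + Z Φ(X, Y) - Φ([X, Y], Z) - Φ([Y, Z], X) - Φ([Z, X], Y)`
(up to a factor `1/3`, which depends on the convention and does not matter for closedness). -/
def extDerivTwoForm
    (Φ : (Π x : M, TangentSpace 𝓘(ℝ, E) x) → (Π x : M, TangentSpace 𝓘(ℝ, E) x) → M → ℝ)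
    (X Y Z : Π x : M, TangentSpace 𝓘(ℝ, E) x) (x : M) : ℝ :=
  mvfderiv 𝓘(ℝ, E) (Φ Y Z) x (X x) + mvfderiv 𝓘(ℝ, E) (Φ Z X) x (Y x)
    + mvfderiv 𝓘(ℝ, E) (Φ X Y) x (Z x)
    - Φ (VectorField.mlieBracket 𝓘(ℝ, E) X Y) Z x
    - Φ (VectorField.mlieBracket 𝓘(ℝ, E) Y Z) X x
    - Φ (VectorField.mlieBracket 𝓘(ℝ, E) Z X) Y x

namespace AlmostContactStructure

/-- Normality, `[φ, φ] + 2 dη ⊗ ξ = 0`. -/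
def IsNormal (S : AlmostContactStructure E M) : Prop :=
  ∀ (X Y : Π x : M, TangentSpace 𝓘(ℝ, E) x), IsSmoothField X → IsSmoothField Y →
    ∀ x, nijenhuis S.φ X Y x + extDerivOneForm S.η X Y x • S.ξ x = 0

variable [RiemannianBundle (fun x : M => TangentSpace 𝓘(ℝ, E) x)]

/-- The Riemannian metric of `M` is compatible with the almost contact structure. -/
structure IsMetricCompatible (S : AlmostContactStructure E M) : Prop where
  inner_φ_φ : ∀ (x : M) (v w : TangentSpace 𝓘(ℝ, E) x),
    inner ℝ (S.φ x v) (S.φ x w) = inner ℝ v w - S.η x v * S.η x w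
  η_eq : ∀ (x : M) (v : TangentSpace 𝓘(ℝ, E) x), S.η x v = inner ℝ v (S.ξ x)

/-- The fundamental two-form `Φ(X, Y) = g(X, φ Y)`. -/
def fundamentalForm (S : AlmostContactStructure E M)
    (X Y : Π x : M, TangentSpace 𝓘(ℝ, E) x) (x : M) : ℝ :=
  inner ℝ (X x) (S.φ x (Y x))

/-- `(φ, ξ, η, g)` is a cosymplectic structure: an almost contact metric structure that is normal
and for which both `η` and the fundamental two-form are closed. -/
structure IsCosymplectic (S : AlmostContactStructure E M) : Prop where
  metric : S.IsMetricCompatible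
  normal : S.IsNormal
  closed_η : ∀ X Y : Π x : M, TangentSpace 𝓘(ℝ, E) x, IsSmoothField X → IsSmoothField Y →
    ∀ x, extDerivOneForm S.η X Y x = 0
  closed_Φ : ∀ X Y Z : Π x : M, TangentSpace 𝓘(ℝ, E) x, IsSmoothField X → IsSmoothField Y →
    IsSmoothField Z → ∀ x, extDerivTwoForm S.fundamentalForm X Y Z x = 0

end AlmostContactStructure

end AlmostContact

section Submersion

variable {E : Type*} [NormedAddCommGroup E] [NormedSpace ℝ E]
  {M : Type*} [TopologicalSpace M] [ChartedSpace E M]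
  {E' : Type*} [NormedAddCommGroup E'] [NormedSpace ℝ E']
  {N : Type*} [TopologicalSpace N] [ChartedSpace E' N]

variable (E E') in
/-- The vertical distribution `ker F_*`. -/
def vertical (F : M → N) (x : M) : Submodule ℝ (TangentSpace 𝓘(ℝ, E) x) :=
  LinearMap.ker (mfderiv 𝓘(ℝ, E) 𝓘(ℝ, E') F x).toLinearMap

variable [RiemannianBundle (fun x : M => TangentSpace 𝓘(ℝ, E) x)]

variable (E E') in
/-- The horizontal distribution `(ker F_*)^⊥`. -/
def horizontal (F : M → N) (x : M) : Submodule ℝ (TangentSpace 𝓘(ℝ, E) x) :=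
  (vertical E E' F x)ᗮ

/-- `F` is a Riemannian submersion: a smooth map onto `N` of maximal rank whose differential
preserves the lengths of horizontal vectors. -/
structure IsRiemannianSubmersion [RiemannianBundle (fun y : N => TangentSpace 𝓘(ℝ, E') y)]
    (F : M → N) : Prop where
  smooth : ContMDiff 𝓘(ℝ, E) 𝓘(ℝ, E') ∞ F
  surjective : Function.Surjective F
  maximal_rank : ∀ x, Function.Surjective (mfderiv 𝓘(ℝ, E) 𝓘(ℝ, E') F x)
  norm_eq : ∀ x, ∀ v ∈ horizontal E E' F x, ‖mfderiv 𝓘(ℝ, E) 𝓘(ℝ, E') F x v‖ = ‖v‖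

/-- `F` is an anti-invariant Riemannian submersion with respect to `(φ, ξ, η)`:
`φ (ker F_*) ⊆ (ker F_*)^⊥`. -/
structure IsAntiInvariantSubmersion [IsManifold 𝓘(ℝ, E) ∞ M]
    [RiemannianBundle (fun y : N => TangentSpace 𝓘(ℝ, E') y)]
    (S : AlmostContactStructure E M) (F : M → N) : Prop extends
    IsRiemannianSubmersion (E := E) (E' := E') F where
  anti_invariant : ∀ x, ∀ v ∈ vertical E E' F x, S.φ x v ∈ horizontal E E' F x

variable [FiniteDimensional ℝ E]

variable (E E') in
/-- The projection `𝒱` of a vector field onto the vertical distribution. -/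
def verProj (F : M → N) (X : Π x : M, TangentSpace 𝓘(ℝ, E) x) :
    Π x : M, TangentSpace 𝓘(ℝ, E) x := fun x =>
  haveI : FiniteDimensional ℝ (TangentSpace 𝓘(ℝ, E) x) := inferInstanceAs (FiniteDimensional ℝ E)
  (vertical E E' F x).starProjection (X x)

variable (E E') in
/-- The projection `ℋ` of a vector field onto the horizontal distribution. -/
def horProj (F : M → N) (X : Π x : M, TangentSpace 𝓘(ℝ, E) x) :
    Π x : M, TangentSpace 𝓘(ℝ, E) x := fun x =>
  haveI : FiniteDimensional ℝ (TangentSpace 𝓘(ℝ, E) x) := inferInstanceAs (FiniteDimensional ℝ E)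
  (horizontal E E' F x).starProjection (X x)

variable [IsManifold 𝓘(ℝ, E) ∞ M]
  [IsContMDiffRiemannianBundle 𝓘(ℝ, E) ∞ E (fun x : M => TangentSpace 𝓘(ℝ, E) x)]

/-- The vector field `∇_X Y`, for the Levi-Civita connection. -/
def nabla (X Y : Π x : M, TangentSpace 𝓘(ℝ, E) x) : Π x : M, TangentSpace 𝓘(ℝ, E) x :=
  fun x => leviCivita E M Y x (X x)

variable (E E') in
/-- O'Neill's tensor `𝒯_X Y = ℋ ∇_{𝒱X} 𝒱Y + 𝒱 ∇_{𝒱X} ℋY`. -/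
def tensorT (F : M → N) (X Y : Π x : M, TangentSpace 𝓘(ℝ, E) x) :
    Π x : M, TangentSpace 𝓘(ℝ, E) x :=
  horProj E E' F (nabla (verProj E E' F X) (verProj E E' F Y))
    + verProj E E' F (nabla (verProj E E' F X) (horProj E E' F Y))

variable (E E') in
/-- O'Neill's tensor `𝒜_X Y = 𝒱 ∇_{ℋX} ℋY + ℋ ∇_{ℋX} 𝒱Y`. -/
def tensorA (F : M → N) (X Y : Π x : M, TangentSpace 𝓘(ℝ, E) x) :
    Π x : M, TangentSpace 𝓘(ℝ, E) x :=
  verProj E E' F (nabla (horProj E E' F X) (horProj E E' F Y))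
    + horProj E E' F (nabla (horProj E E' F X) (verProj E E' F Y))

end Submersion

section LocalProduct

/-- `g` is a Riemannian metric on the open subset `U` of a Euclidean space. -/
structure IsRiemannianMetricOn {k : ℕ} (U : Set (EuclideanSpace ℝ (Fin k)))
    (g : EuclideanSpace ℝ (Fin k) →
      EuclideanSpace ℝ (Fin k) →L[ℝ] EuclideanSpace ℝ (Fin k) →L[ℝ] ℝ) : Prop where
  smooth : ContDiffOn ℝ ∞ g U
  symm : ∀ a ∈ U, ∀ u v, g a u v = g a v u
  pos : ∀ a ∈ U, ∀ u, u ≠ 0 → 0 < g a u u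

/-- `M` is locally a Riemannian product of leaves of the distributions `D₁` and `D₂`: every point
has an open neighbourhood `Ψ (U₁ × U₂)`, where `(U₁, g₁)` and `(U₂, g₂)` are connected Riemannian
manifolds (each covered by one chart) and `Ψ` is a diffeomorphism onto its open image that takes the
product metric `g₁ ⊕ g₂` to the metric of `M` and the canonical foliations of `U₁ × U₂` to `D₁` and
`D₂`, so that the `Ψ (U₁ × {b})` are open pieces of leaves of `D₁` and the `Ψ ({a} × U₂)` are open
pieces of leaves of `D₂`. -/
def IsLocallyRiemannianProduct {E : Type*} [NormedAddCommGroup E] [NormedSpace ℝ E]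
    {M : Type*} [TopologicalSpace M] [ChartedSpace E M]
    [RiemannianBundle (fun x : M => TangentSpace 𝓘(ℝ, E) x)]
    (D₁ D₂ : Π x : M, Submodule ℝ (TangentSpace 𝓘(ℝ, E) x)) : Prop :=
  ∀ p : M, ∃ (k l : ℕ)
    (U₁ : Set (EuclideanSpace ℝ (Fin k))) (U₂ : Set (EuclideanSpace ℝ (Fin l)))
    (g₁ : EuclideanSpace ℝ (Fin k) →
      EuclideanSpace ℝ (Fin k) →L[ℝ] EuclideanSpace ℝ (Fin k) →L[ℝ] ℝ)
    (g₂ : EuclideanSpace ℝ (Fin l) →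
      EuclideanSpace ℝ (Fin l) →L[ℝ] EuclideanSpace ℝ (Fin l) →L[ℝ] ℝ)
    (Ψ : OpenPartialHomeomorph (EuclideanSpace ℝ (Fin k) × EuclideanSpace ℝ (Fin l)) M),
    IsOpen U₁ ∧ IsConnected U₁ ∧ IsRiemannianMetricOn U₁ g₁ ∧
    IsOpen U₂ ∧ IsConnected U₂ ∧ IsRiemannianMetricOn U₂ g₂ ∧
    Ψ.source = U₁ ×ˢ U₂ ∧ p ∈ Ψ.target ∧
    ContMDiffOn 𝓘(ℝ, EuclideanSpace ℝ (Fin k) × EuclideanSpace ℝ (Fin l)) 𝓘(ℝ, E) ∞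
      Ψ Ψ.source ∧
    ContMDiffOn 𝓘(ℝ, E) 𝓘(ℝ, EuclideanSpace ℝ (Fin k) × EuclideanSpace ℝ (Fin l)) ∞
      Ψ.symm Ψ.target ∧
    ∀ a ∈ U₁, ∀ b ∈ U₂,
      let dΨ : EuclideanSpace ℝ (Fin k) × EuclideanSpace ℝ (Fin l) →
          TangentSpace 𝓘(ℝ, E) (Ψ (a, b)) :=
        mfderiv 𝓘(ℝ, EuclideanSpace ℝ (Fin k) × EuclideanSpace ℝ (Fin l)) 𝓘(ℝ, E) Ψ (a, b)
      (∀ u u' v v', inner ℝ (dΨ (u, v)) (dΨ (u', v')) = g₁ a u u' + g₂ b v v') ∧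
      (∀ w, w ∈ D₁ (Ψ (a, b)) ↔ ∃ u, w = dΨ (u, 0)) ∧
      (∀ w, w ∈ D₂ (Ψ (a, b)) ↔ ∃ v, w = dΨ (0, v))

end LocalProduct

end RiemGeom

end

/-!
Call a distribution `D` with orthogonal complement `D'` totally geodesic if `∇_v Y` is orthogonal to
`D'` for `v`, `Y` tangent to `D` (`IsTotallyGeodesic`). Both assertions of the theorem say that the
vertical and the horizontal distribution are totally geodesic.

For O'Neill's tensors this is algebra. As `φ (ker F_*) = (ker F_*)ᗮ`, the field `ξ` is vertical and
`φ` maps horizontal vectors to vertical ones. For vertical `V`, `W` the field `𝒯_V φW` is the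
vertical part of `∇_V φW`, and `g(∇_V U, φW) = -g(U, ∇_V φW)` for vertical `U`, where the `φW`
exhaust the horizontal vectors (`isTotallyGeodesic_vertical_iff`). For horizontal `X`, `Y` the field
`𝒜_X φY` is the horizontal part of `∇_X φY`. Here the `φY` only exhaust the vertical vectors
orthogonal to `ξ`. The missing direction needs `g(∇_X Y, ξ) = -g(Y, ∇_X ξ) = 0`, a consequence of
normality and of the closedness of `η` and of the fundamental form
(`AlmostContactStructure.IsCosymplectic.inner_leviCivita_ξ`, `isTotallyGeodesic_horizontal_iff`).

For local products, write the metric in coordinates in which both distributions are spanned by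
coordinate fields. By the Koszul formula, a distribution is totally geodesic iff its block of metric
coefficients does not depend on the transverse coordinates, so that a product metric and a pair of
orthogonal totally geodesic distributions are the same thing, once such coordinates are available
(`IsLocallyRiemannianProduct.isTotallyGeodesic`,
`isLocallyRiemannianProduct_of_isTotallyGeodesic`). A submersion has coordinates in which the
vertical distribution is constant (`exists_param_of_submersion`), and the horizontal one is then the
graph of a matrix-valued function `A`. If the horizontal distribution is totally geodesic, brackets
of horizontal fields are horizontal, which is the integrability condition for `A`, and the Frobenius
theorem (`exists_foliated_coordinates`) straightens both distributions
(`exists_param_of_isTotallyGeodesic_horizontal`).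

The Frobenius theorem is proved with the inverse function theorem in a Banach space of paths: the
integral manifolds are made of solutions of the ordinary differential equation along rays, and these
solutions depend smoothly on the ray and on the initial value because the superposition operator of
a smooth function on continuous paths is smooth (`contDiff_comp_continuousMap`).
-/

noncomputable section

namespace RiemGeom

open Set Filter Topology

/-! ### Smoothness of composition operators on spaces of continuous maps -/

section Nemytskii

variable (T : Type*) [TopologicalSpace T] [CompactSpace T]
  (E F : Type*) [NormedAddCommGroup E] [NormedSpace ℝ E] [NormedAddCommGroup F] [NormedSpace ℝ F]

/-- Pointwise application of a continuous bilinear map to continuous families, as a continuous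
bilinear map between spaces of continuous maps. -/
def pointwiseBilin {G : Type*} [NormedAddCommGroup G] [NormedSpace ℝ G] (b : G →L[ℝ] E →L[ℝ] F) :
    C(T, G) →L[ℝ] C(T, E) →L[ℝ] C(T, F) :=
  LinearMap.mkContinuous₂
    (LinearMap.mk₂ ℝ (fun (L : C(T, G)) (z : C(T, E)) =>
        (⟨fun t => b (L t) (z t), (b.continuous.comp L.continuous).clm_apply z.continuous⟩ :
          C(T, F)))
      (fun _ _ _ => by ext; simp) (fun _ _ _ => by ext; simp)
      (fun _ _ _ => by ext; simp) (fun _ _ _ => by ext; simp)) ‖b‖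
    (fun L z => by
      rw [ContinuousMap.norm_le _ (by positivity)]
      intro t
      refine (b.le_opNorm₂ _ _).trans ?_
      gcongr
      · exact L.norm_coe_le_norm t
      · exact z.norm_coe_le_norm t)

/-- A shortcut instance: without it, the search for the norm on families of operators is too
slow. -/
instance normedAddCommGroupOperatorFamily : NormedAddCommGroup C(T, E →L[ℝ] F) :=
  ContinuousMap.instNormedAddCommGroup

instance normedSpaceOperatorFamily : NormedSpace ℝ C(T, E →L[ℝ] F) :=
  ContinuousMap.normedSpace

/-- Pointwise evaluation of a continuous family of operators on a continuous family of vectors, as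
a continuous bilinear map. -/
def pointwiseApply : C(T, E →L[ℝ] F) →L[ℝ] C(T, E) →L[ℝ] C(T, F) :=
  pointwiseBilin T E F (ContinuousLinearMap.id ℝ (E →L[ℝ] F))

@[simp] theorem pointwiseApply_apply (L : C(T, E →L[ℝ] F)) (z : C(T, E)) (t : T) :
    pointwiseApply T E F L z t = L t (z t) := rfl

variable {T E F}

/-- The derivative of `z ↦ f ∘ z` is the pointwise derivative. The remainder is controlled uniformly
on the compact space because `z ↦ f' ∘ z` is continuous for the sup norm. -/
theorem hasFDerivAt_comp_continuousMap (f : C(E, F)) (f' : C(E, E →L[ℝ] F))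
    (hf : ∀ x, HasFDerivAt f (f' x) x) (z : C(T, E)) :
    HasFDerivAt (fun z : C(T, E) => f.comp z) (pointwiseApply T E F (f'.comp z)) z := by
  rw [hasFDerivAt_iff_isLittleO_nhds_zero, Asymptotics.isLittleO_iff]
  intro c hc
  have hcont : Continuous fun h : C(T, E) => f'.comp (z + h) :=
    (ContinuousMap.continuous_postcomp f').comp (continuous_const.add continuous_id)
  obtain ⟨δ, hδ, hball⟩ := Metric.continuousAt_iff.1 (hcont.continuousAt (x := 0)) c hc
  filter_upwards [Metric.ball_mem_nhds (0 : C(T, E)) hδ] with h hh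
  rw [ContinuousMap.norm_le _ (by positivity)]
  intro t
  have key := Convex.norm_image_sub_le_of_norm_hasFDerivWithin_le' (𝕜 := ℝ) (f := f)
    (f' := f') (φ := f' (z t)) (C := c) (s := segment ℝ (z t) (z t + h t))
    (x := z t) (y := z t + h t) (fun x _ => (hf x).hasFDerivWithinAt) (fun x hx => ?_)
    (convex_segment _ _) (left_mem_segment ..) (right_mem_segment ..)
  · simp only [add_sub_cancel_left] at key
    simpa using key.trans (mul_le_mul_of_nonneg_left (h.norm_coe_le_norm t) hc.le)
  · -- a point of the segment is the value at `t` of `z + s • h` for some `s ∈ [0, 1]`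
    rw [segment_eq_image'] at hx
    obtain ⟨s, hs, rfl⟩ := hx
    have h1 : s • h ∈ Metric.ball (0 : C(T, E)) δ := by
      rw [mem_ball_zero_iff] at hh ⊢
      rw [norm_smul, Real.norm_of_nonneg hs.1]
      nlinarith [hs.2, norm_nonneg h]
    have h2 := (hball h1).le
    rw [dist_eq_norm] at h2
    have h3 := (ContinuousMap.norm_coe_le_norm _ t).trans h2
    simpa using h3

universe u

/-- `E` and `F` share a universe because the induction on the order of differentiability passes from
`F` to `E →L[ℝ] F`. -/
theorem contDiff_nat_comp_continuousMap {T : Type*} [TopologicalSpace T] [CompactSpace T]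
    {E : Type u} [NormedAddCommGroup E] [NormedSpace ℝ E] (n : ℕ) :
    ∀ {F : Type u} [NormedAddCommGroup F] [NormedSpace ℝ F] (f : C(E, F)), ContDiff ℝ n f →
      ContDiff ℝ n (fun z : C(T, E) => f.comp z) := by
  induction n with
  | zero =>
    intro F _ _ f _
    exact contDiff_zero.2 (ContinuousMap.continuous_postcomp f)
  | succ n ih =>
    intro F _ _ f hf
    rw [Nat.cast_succ] at hf ⊢
    obtain ⟨f', hf', hd⟩ := contDiff_succ_iff_hasFDerivAt.1 hf
    let g : C(E, E →L[ℝ] F) := ⟨f', hf'.continuous⟩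
    exact contDiff_succ_iff_hasFDerivAt.2
      ⟨_, (pointwiseApply T E F).contDiff.comp (ih g hf'),
        fun z => hasFDerivAt_comp_continuousMap f g hd z⟩

/-- The superposition operator `z ↦ f ∘ z` on continuous maps on a compact space is as smooth as
`f`. -/
theorem contDiff_comp_continuousMap {T : Type*} [TopologicalSpace T] [CompactSpace T]
    {E F : Type u} [NormedAddCommGroup E] [NormedSpace ℝ E] [NormedAddCommGroup F]
    [NormedSpace ℝ F] (f : C(E, F)) (hf : ContDiff ℝ ∞ f) :
    ContDiff ℝ ∞ (fun z : C(T, E) => f.comp z) :=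
  contDiff_infty.2 fun n => contDiff_nat_comp_continuousMap n f (contDiff_infty.1 hf n)

end Nemytskii

/-! ### The integral operator -/

section Integral

open intervalIntegral

variable (F : Type*) [NormedAddCommGroup F] [NormedSpace ℝ F]

/-- The primitive `t ↦ ∫₀ᵗ f` of a continuous function on the unit interval, as a bounded operator.
Outside `[0, 1]`, `f` is extended by its boundary values. -/
def primitiveCLM : C(unitInterval, F) →L[ℝ] C(unitInterval, F) :=
  LinearMap.mkContinuous
    { toFun := fun f => ⟨fun t => ∫ s in (0 : ℝ)..t, f (projIcc 0 1 zero_le_one s),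
        (continuous_primitive (fun a b => (f.continuous.comp continuous_projIcc).intervalIntegrable
          a b) 0).comp continuous_subtype_val⟩
      map_add' := fun f g => by
        ext t
        exact integral_add ((f.continuous.comp continuous_projIcc).intervalIntegrable _ _)
          ((g.continuous.comp continuous_projIcc).intervalIntegrable _ _)
      map_smul' := fun c f => by
        ext t
        exact integral_smul c _ } 1
    (fun f => by
      rw [one_mul, ContinuousMap.norm_le _ (norm_nonneg f)]
      intro t
      refine (norm_integral_le_of_norm_le_const
        (fun s _ => f.norm_coe_le_norm (projIcc 0 1 zero_le_one s))).trans ?_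
      rw [sub_zero, abs_of_nonneg t.2.1]
      exact mul_le_of_le_one_right (norm_nonneg f) t.2.2)

variable {F}

/-- A path that satisfies an integral equation satisfies the corresponding differential
equation. -/
theorem hasDerivAt_of_eq_primitive [CompleteSpace F] {z f : C(unitInterval, F)} {c : F}
    (h : z = ContinuousMap.const _ c + primitiveCLM F f) {g : ℝ → F}
    (hg : g = fun t => c + ∫ s in (0 : ℝ)..t, f (projIcc 0 1 zero_le_one s)) :
    (∀ t : unitInterval, z t = g t) ∧ g 0 = c ∧
      ∀ t : unitInterval, HasDerivAt g (f t) t := by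
  subst hg
  refine ⟨fun t => by rw [h]; rfl, by simp, fun t => ?_⟩
  have hc := f.continuous.comp (continuous_projIcc (h := zero_le_one (α := ℝ)))
  have := (hc.integral_hasStrictDerivAt 0 (t : ℝ)).hasDerivAt.const_add c
  simpa using this

end Integral

/-! ### The inverse function theorem on open sets -/

/-- The inverse function theorem for a smooth function on an open set. The source of the local
inverse is shrunk to points with invertible derivative, so that the inverse is smooth everywhere. -/
theorem exists_openPartialHomeomorph_of_bijective_fderiv
    {E F : Type*} [NormedAddCommGroup E] [NormedSpace ℝ E] [CompleteSpace E]
    [NormedAddCommGroup F] [NormedSpace ℝ F] [CompleteSpace F]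
    {f : E → F} {O : Set E} (hO : IsOpen O) (hf : ContDiffOn ℝ ∞ f O) {x : E} (hx : x ∈ O)
    (hb : Function.Bijective (fderiv ℝ f x)) :
    ∃ e : OpenPartialHomeomorph E F, (e : E → F) = f ∧ x ∈ e.source ∧ e.source ⊆ O ∧
      ContDiffOn ℝ ∞ e e.source ∧ ContDiffOn ℝ ∞ e.symm e.target := by
  have hfx : ContDiffAt ℝ ∞ f x := hf.contDiffAt (hO.mem_nhds hx)
  let L : E ≃L[ℝ] F := ContinuousLinearEquiv.ofBijective (fderiv ℝ f x)
    (LinearMap.ker_eq_bot.2 hb.1) (LinearMap.range_eq_top.2 hb.2)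
  have hL : HasFDerivAt f (L : E →L[ℝ] F) x := by
    have hLc : (L : E →L[ℝ] F) = fderiv ℝ f x := ContinuousLinearEquiv.coe_ofBijective _ _ _
    rw [hLc]
    exact (hfx.differentiableAt (by simp)).hasFDerivAt
  let e₀ := hfx.toOpenPartialHomeomorph f hL (by simp)
  have hdcont : ContinuousOn (fderiv ℝ f) O := hf.continuousOn_fderiv_of_isOpen hO (by simp)
  let O' : Set E := O ∩ fderiv ℝ f ⁻¹' range ContinuousLinearEquiv.toContinuousLinearMap
  have hO' : IsOpen O' := hdcont.isOpen_inter_preimage hO ContinuousLinearEquiv.isOpen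
  have hxO' : x ∈ O' := ⟨hx, L, hL.fderiv.symm⟩
  let e := e₀.restrOpen O' hO'
  refine ⟨e, rfl, ⟨hfx.mem_toOpenPartialHomeomorph_source hL _, hxO'⟩, fun y hy => hy.2.1,
    hf.mono fun y hy => hy.2.1, fun y hy => ?_⟩
  have hy' := e.map_target hy
  obtain ⟨⟨hyO, L', hL'⟩⟩ := And.intro hy'.2 trivial
  have hfy : ContDiffAt ℝ ∞ f (e.symm y) := hf.contDiffAt (hO.mem_nhds hyO)
  refine (e.contDiffAt_symm hy (f₀' := L') ?_ hfy).contDiffWithinAt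
  rw [hL']
  exact (hfy.differentiableAt (by simp)).hasFDerivAt

/-! ### The Frobenius theorem for graphs -/

section Frobenius

universe u

variable {X W : Type u} [NormedAddCommGroup X] [NormedSpace ℝ X] [FiniteDimensional ℝ X]
  [NormedAddCommGroup W] [NormedSpace ℝ W] [FiniteDimensional ℝ W]

variable (X) in
/-- The inclusion of the constant paths. -/
def constPath : X →L[ℝ] C(unitInterval, X) :=
  LinearMap.toContinuousLinearMap
    { toFun := fun a => ContinuousMap.const _ a
      map_add' := fun _ _ => rfl
      map_smul' := fun _ _ => rfl }

variable (X W) in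
/-- The linear map that sends a path `z` in `X` and a vector `w` of `W` to the path
`t ↦ (z t, t • w, w)`. -/
def rayPath : C(unitInterval, X) × W →L[ℝ] C(unitInterval, X × W × W) :=
  ((ContinuousLinearMap.inl ℝ X (W × W)).compLeftContinuous ℝ unitInterval).comp
      (ContinuousLinearMap.fst ℝ _ _)
    + (LinearMap.toContinuousLinearMap
        { toFun := fun w : W => (⟨fun t => (0, (t : ℝ) • w, w), by fun_prop⟩ :
            C(unitInterval, X × W × W))
          map_add' := fun _ _ => by ext <;> simp
          map_smul' := fun c _ => by ext <;> simp [smul_smul, mul_comm] }).comp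
      (ContinuousLinearMap.snd ℝ _ _)

omit [FiniteDimensional ℝ X] in
@[simp] theorem rayPath_apply (z : C(unitInterval, X)) (w : W) (t : unitInterval) :
    rayPath X W (z, w) t = (z t, (t : ℝ) • w, w) := by
  change ((z t, 0) : X × W × W) + (0, (t : ℝ) • w, w) = _
  simp

/-- The right-hand side `(x, u, w) ↦ A (x, u) w` of the differential equation along rays. -/
def raySlope (A : X × W → W →L[ℝ] X) (hA : ContDiff ℝ ∞ A) : C(X × W × W, X) :=
  ⟨fun q => A (q.1, q.2.1) q.2.2,
    (hA.continuous.comp (by fun_prop)).clm_apply (by fun_prop)⟩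

/-- The solutions `z` of `z' = A (z, t w) w`, `z 0 = a` on `[0, 1]` form a smooth family in `(a, w)`
near `0`. As `z = 0` solves the equation for `(a, w) = 0` and the integral operator vanishes
identically for `w = 0`, the inverse function theorem applies in the space of paths. -/
theorem exists_smooth_family_of_rays (A : X × W → W →L[ℝ] X) (hA : ContDiff ℝ ∞ A) :
    ∃ (O : Set (X × W)) (Z : X × W → C(unitInterval, X)), IsOpen O ∧ 0 ∈ O ∧
      ContDiffOn ℝ ∞ Z O ∧ Z 0 = 0 ∧ ∀ p ∈ O, Z p = constPath X p.1
        + primitiveCLM X ((raySlope A hA).comp (rayPath X W (Z p, p.2))) := by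
  let Φ : (X × W) × C(unitInterval, X) → C(unitInterval, X) := fun q =>
    q.2 - constPath X q.1.1 - primitiveCLM X ((raySlope A hA).comp (rayPath X W (q.2, q.1.2)))
  have hslope : ContDiff ℝ ∞ (raySlope A hA) := by
    change ContDiff ℝ ∞ fun q : X × W × W => A (q.1, q.2.1) q.2.2
    exact (hA.comp (by fun_prop)).clm_apply (by fun_prop)
  have hΦ : ContDiff ℝ ∞ Φ := by
    have h1 : ContDiff ℝ ∞ fun q : (X × W) × C(unitInterval, X) =>
        (raySlope A hA).comp (rayPath X W (q.2, q.1.2)) :=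
      (contDiff_comp_continuousMap (T := unitInterval) (raySlope A hA) hslope).comp
        ((rayPath X W).contDiff.comp (by fun_prop))
    exact (contDiff_snd.sub ((constPath X).contDiff.comp (by fun_prop))).sub
      ((primitiveCLM X).contDiff.comp h1)
  have hΦ0 : ∀ z, Φ (0, z) = z := by
    intro z
    have : (raySlope A hA).comp (rayPath X W (z, 0)) = 0 := by
      ext t; simp [raySlope]
    simp [Φ, this]
  let Ξ : (X × W) × C(unitInterval, X) → (X × W) × C(unitInterval, X) := fun q => (q.1, Φ q)
  have hΞ : ContDiff ℝ ∞ Ξ := contDiff_fst.prodMk hΦ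
  have hdΦ : HasFDerivAt Φ (fderiv ℝ Φ 0) 0 := (hΦ.differentiable (by simp) 0).hasFDerivAt
  have hdΞ : fderiv ℝ Ξ 0 = (ContinuousLinearMap.fst ℝ _ _).prod (fderiv ℝ Φ 0) :=
    (hasFDerivAt_fst.prodMk hdΦ).fderiv
  have hD : ∀ z, fderiv ℝ Φ 0 (0, z) = z := by
    intro z
    have h1 : HasFDerivAt (fun z => Φ ((0 : X × W), z))
        ((fderiv ℝ Φ 0).comp (ContinuousLinearMap.inr ℝ (X × W) _)) 0 :=
      HasFDerivAt.comp (0 : C(unitInterval, X)) (g := Φ) hdΦ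
        (hasFDerivAt_prodMk_right (0 : X × W) (0 : C(unitInterval, X)))
    have h2 : HasFDerivAt (fun z => Φ ((0 : X × W), z)) (ContinuousLinearMap.id ℝ _) 0 := by
      simp only [hΦ0]; exact hasFDerivAt_id _
    simpa using congrArg (fun L => L z) (h1.unique h2)
  have hD' : ∀ p z, fderiv ℝ Φ 0 (p, z) = fderiv ℝ Φ 0 (p, 0) + z := by
    intro p z
    rw [← hD z, ← map_add, hD]; simp
  have hbij : Function.Bijective (fderiv ℝ Ξ 0) := by
    rw [hdΞ]
    constructor
    · rintro ⟨p, z⟩ ⟨p', z'⟩ h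
      simp only [ContinuousLinearMap.prod_apply, ContinuousLinearMap.coe_fst', Prod.mk.injEq] at h
      obtain ⟨rfl, h⟩ := h
      rw [hD' p z, hD' p z'] at h
      simp [add_left_cancel h]
    · rintro ⟨p, z⟩
      refine ⟨(p, z - fderiv ℝ Φ 0 (p, 0)), ?_⟩
      simp only [ContinuousLinearMap.prod_apply, ContinuousLinearMap.coe_fst', Prod.mk.injEq]
      exact ⟨trivial, by rw [hD']; abel⟩
  obtain ⟨e, he, h0, -, -, hsymm⟩ := exists_openPartialHomeomorph_of_bijective_fderiv isOpen_univ
    hΞ.contDiffOn (mem_univ 0) hbij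
  have hΞ0 : Ξ 0 = 0 := Prod.ext rfl (hΦ0 0)
  refine ⟨(fun p => (p, 0)) ⁻¹' e.target, fun p => (e.symm (p, 0)).2,
    e.open_target.preimage (by fun_prop), ?_, ?_, ?_, ?_⟩
  · have := e.map_source h0
    rwa [he, hΞ0] at this
  · exact contDiff_snd.comp_contDiffOn (hsymm.comp (by fun_prop) fun p hp => hp)
  · have := e.left_inv h0
    rw [he, hΞ0] at this
    change (e.symm 0).2 = 0
    rw [this]; rfl
  · intro p hp
    have h1 := e.right_inv hp
    rw [he] at h1
    have h2 : (e.symm (p, 0)).1 = p := congrArg Prod.fst h1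
    have h3 : Φ (e.symm (p, 0)) = 0 := congrArg Prod.snd h1
    simp only [Φ, h2] at h3
    rw [sub_sub, sub_eq_zero] at h3
    exact h3

omit [FiniteDimensional ℝ X] [FiniteDimensional ℝ W] in
theorem hasFDerivAt_raySlope {A : X × W → W →L[ℝ] X} (hA : ContDiff ℝ ∞ A) (q : X × W × W) :
    HasFDerivAt (raySlope A hA) (fderiv ℝ (raySlope A hA) q) q ∧ ∀ dx du dw,
      fderiv ℝ (raySlope A hA) q (dx, du, dw)
        = fderiv ℝ A (q.1, q.2.1) (dx, du) q.2.2 + A (q.1, q.2.1) dw := by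
  have h1 : HasFDerivAt (fun q : X × W × W => A (q.1, q.2.1))
      ((fderiv ℝ A (q.1, q.2.1)).comp ((ContinuousLinearMap.fst ℝ X (W × W)).prod
        ((ContinuousLinearMap.fst ℝ W W).comp (ContinuousLinearMap.snd ℝ X (W × W))))) q :=
    HasFDerivAt.comp q (g := A) (hA.differentiable (by simp) _).hasFDerivAt
      (hasFDerivAt_fst.prodMk (hasFDerivAt_fst.comp q hasFDerivAt_snd))
  have h2 : HasFDerivAt (fun q : X × W × W => q.2.2)
      ((ContinuousLinearMap.snd ℝ W W).comp (ContinuousLinearMap.snd ℝ X (W × W))) q :=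
    hasFDerivAt_snd.comp q hasFDerivAt_snd
  have h3 := h1.clm_apply h2
  have h4 : HasFDerivAt (raySlope A hA) _ q := h3
  refine ⟨h4.differentiableAt.hasFDerivAt, fun dx du dw => ?_⟩
  rw [h4.fderiv]
  simp [add_comm]

set_option synthInstance.maxHeartbeats 200000 in
/-- The Frobenius theorem for the distribution of the graphs of `A (x, u) : W → X`, in the form of
a total differential equation: an integrable system `∂ζ/∂u = A (ζ, u)` has a smooth family of
solutions with arbitrary initial values. The solutions are built along the rays `t ↦ t w`: with
`Z` the family of rays, `ζ (a, w) = Z (a, w) 1`. -/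
theorem exists_family_of_integral_graphs (A : X × W → W →L[ℝ] X) (hA : ContDiff ℝ ∞ A)
    {Ω : Set (X × W)} (hΩ : Ω ∈ 𝓝 0)
    (hint : ∀ q ∈ Ω, ∀ v w, fderiv ℝ A q (A q w, w) v = fderiv ℝ A q (A q v, v) w) :
    ∃ (O : Set (X × W)) (ζ : X × W → X), IsOpen O ∧ 0 ∈ O ∧ ContDiffOn ℝ ∞ ζ O ∧ ζ 0 = 0 ∧
      (∀ p ∈ O, ∀ v, fderiv ℝ ζ p (0, v) = A (ζ p, p.2) v) ∧
      ∀ a, (a, 0) ∈ O → ζ (a, 0) = a := by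
  obtain ⟨O, Z, hO, h0, hZ, hZ0, hZeq⟩ := exists_smooth_family_of_rays A hA
  obtain ⟨r, hr, hball⟩ := Metric.mem_nhds_iff.1 hΩ
  let O' : Set (X × W) := O ∩ Z ⁻¹' Metric.ball 0 r ∩ Prod.snd ⁻¹' Metric.ball 0 r
  have hO' : IsOpen O' := (hZ.continuousOn.isOpen_inter_preimage hO Metric.isOpen_ball).inter
    (Metric.isOpen_ball.preimage continuous_snd)
  refine ⟨O', fun p => Z p 1, hO', ⟨⟨h0, by simp [hZ0, hr]⟩, by simp [hr]⟩, ?_, by simp [hZ0],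
    ?_, ?_⟩
  · exact (ContinuousMap.evalCLM (M := X) ℝ (1 : unitInterval)).contDiff.comp_contDiffOn
      (hZ.mono fun p (hp : p ∈ O') => hp.1.1)
  · rintro ⟨a, w⟩ ⟨⟨hp, hpZ⟩, hpw⟩ v
    have hZd : HasFDerivAt Z (fderiv ℝ Z (a, w)) (a, w) :=
      ((hZ.contDiffAt (hO.mem_nhds hp)).differentiableAt (by simp)).hasFDerivAt
    set S := fderiv ℝ Z (a, w) (0, v) with hS
    have hev : HasFDerivAt (fun p => Z p 1)
        ((ContinuousMap.evalCLM ℝ (1 : unitInterval)).comp (fderiv ℝ Z (a, w))) (a, w) :=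
      (ContinuousMap.evalCLM (M := X) ℝ (1 : unitInterval)).hasFDerivAt.comp (a, w) hZd
    rw [hev.fderiv]
    change S 1 = A (Z (a, w) 1, w) v
    -- the integral equation, and its derivative in the direction `(0, v)`
    let slope' : C(X × W × W, X × W × W →L[ℝ] X) := ⟨fderiv ℝ (raySlope A hA), by
      have hslope : ContDiff ℝ ∞ (raySlope A hA) := by
        change ContDiff ℝ ∞ fun q : X × W × W => A (q.1, q.2.1) q.2.2
        exact (hA.comp (by fun_prop)).clm_apply (by fun_prop)
      exact hslope.continuous_fderiv (by simp)⟩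
    set f : C(unitInterval, X) := (raySlope A hA).comp (rayPath X W (Z (a, w), w)) with hf
    set f' : C(unitInterval, X) := pointwiseApply _ _ _
      (slope'.comp (rayPath X W (Z (a, w), w))) (rayPath X W (S, v)) with hf'
    have hZ1 : Z (a, w) = ContinuousMap.const _ a + primitiveCLM X f := hZeq _ hp
    have hS1 : S = ContinuousMap.const _ 0 + primitiveCLM X f' := by
      have h1 : HasFDerivAt (fun p : X × W => rayPath X W (Z p, p.2))
          ((rayPath X W).comp ((fderiv ℝ Z (a, w)).prod (ContinuousLinearMap.snd ℝ X W))) (a, w) :=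
        (rayPath X W).hasFDerivAt.comp (a, w) (hZd.prodMk hasFDerivAt_snd)
      have h2 := (hasFDerivAt_comp_continuousMap (raySlope A hA) slope'
        (fun q => (hasFDerivAt_raySlope hA q).1) (rayPath X W (Z (a, w), w))).comp (a, w) h1
      have h3 := (((constPath X).hasFDerivAt.comp (a, w) hasFDerivAt_fst).add
        ((primitiveCLM X).hasFDerivAt.comp (a, w) h2))
      have h4 := h3.congr_of_eventuallyEq (f₁ := Z)
        (eventually_of_mem (hO.mem_nhds hp) fun p hp => hZeq p hp)
      have h5 := congrArg (fun L => L (0, v)) (hZd.unique h4)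
      rw [hS]
      refine h5.trans ?_
      rfl
    obtain ⟨hz, hz0, hzd⟩ := hasDerivAt_of_eq_primitive hZ1 rfl
    obtain ⟨hs, hs0, hsd⟩ := hasDerivAt_of_eq_primitive hS1 rfl
    set z : ℝ → X := fun t => a + ∫ s in (0 : ℝ)..t, f (projIcc 0 1 zero_le_one s)
    set σ : ℝ → X := fun t => 0 + ∫ s in (0 : ℝ)..t, f' (projIcc 0 1 zero_le_one s)
    have hAd : ∀ q, HasFDerivAt A (fderiv ℝ A q) q := fun q =>
      (hA.differentiable (by simp) q).hasFDerivAt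
    -- the defect of the differential equation vanishes at `0` and, by integrability, satisfies a
    -- linear differential equation
    let d : ℝ → X := fun t => σ t - t • A (z t, t • w) v
    have hd : ∀ t ∈ Icc (0 : ℝ) 1, HasDerivAt d (fderiv ℝ A (z t, t • w) (d t, 0) w) t := by
      intro t ht
      have e1 := hzd ⟨t, ht⟩
      have e2 := hsd ⟨t, ht⟩
      have e3 : f ⟨t, ht⟩ = A (z t, t • w) w := by
        rw [hf, ContinuousMap.comp_apply, rayPath_apply, hz ⟨t, ht⟩]; rfl
      have e4 : f' ⟨t, ht⟩ = fderiv ℝ A (z t, t • w) (σ t, t • v) w + A (z t, t • w) v := by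
        rw [hf', pointwiseApply_apply, ContinuousMap.comp_apply, rayPath_apply, rayPath_apply,
          hz ⟨t, ht⟩, hs ⟨t, ht⟩]
        exact (hasFDerivAt_raySlope hA _).2 _ _ _
      rw [e3] at e1
      rw [e4] at e2
      have e5 : HasDerivAt (fun t => A (z t, t • w)) (fderiv ℝ A (z t, t • w)
          (A (z t, t • w) w, (1 : ℝ) • w)) t :=
        (hAd _).comp_hasDerivAt t (e1.prodMk ((hasDerivAt_id t).smul_const w))
      have e6 := (hasDerivAt_id t).smul (e5.clm_apply (hasDerivAt_const t v))
      have e7 := e2.sub e6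
      have hq : (z t, t • w) ∈ Ω := by
        apply hball
        rw [mem_ball_zero_iff, Prod.norm_def, max_lt_iff]
        rw [mem_preimage, mem_ball_zero_iff] at hpZ hpw
        refine ⟨(hz ⟨t, ht⟩ ▸ ContinuousMap.norm_coe_le_norm _ _).trans_lt hpZ, ?_⟩
        rw [norm_smul, Real.norm_of_nonneg ht.1]
        exact (mul_le_of_le_one_left (norm_nonneg _) ht.2).trans_lt hpw
      refine e7.congr_deriv ?_
      have e8 : ((d t, 0) : X × W) = (σ t, t • v) - t • (A (z t, t • w) v, v) := by
        simp [d]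
      rw [e8, map_sub, map_smul, sub_apply, smul_apply, ← hint _ hq v w]
      simp only [id, one_smul, map_zero, add_zero]
      abel
    have hdc : ContinuousOn d (Icc 0 1) := fun t ht => (hd t ht).continuousAt.continuousWithinAt
    have hzc : ContinuousOn (fun t => fderiv ℝ A (z t, t • w)) (Icc 0 1) :=
      (hA.continuous_fderiv (by simp)).comp_continuousOn
        (ContinuousOn.prodMk (fun t ht => (hzd ⟨t, ht⟩).continuousAt.continuousWithinAt)
          (by fun_prop))
    obtain ⟨K, hK⟩ := isCompact_Icc.bddAbove_image
      ((continuous_norm (E := X × W →L[ℝ] W →L[ℝ] X)).comp_continuousOn hzc)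
    have := eq_zero_of_abs_deriv_le_mul_abs_self_of_eq_zero_right (K := K * ‖w‖) hdc
      (fun t ht => (hd t ⟨ht.1, ht.2.le⟩).hasDerivWithinAt) (by simp [d, σ])
      (fun t ht => by
        refine ((ContinuousLinearMap.le_opNorm _ _).trans
          (mul_le_mul_of_nonneg_right (ContinuousLinearMap.le_opNorm _ _) (norm_nonneg _))).trans ?_
        have h1 : ‖((d t, 0) : X × W)‖ = ‖d t‖ := by simp [Prod.norm_def]
        rw [h1, mul_right_comm]
        gcongr
        exact hK (mem_image_of_mem _ ⟨ht.1, ht.2.le⟩)) 1 (right_mem_Icc.2 zero_le_one)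
    have h1 : σ 1 = A (z 1, w) v := by simpa [d, sub_eq_zero] using this
    rw [hs 1, hz 1]
    exact h1
  · intro a ha
    have h1 := congrArg (fun z => z 1) (hZeq _ ha.1.1)
    have : (raySlope A hA).comp (rayPath X W (Z (a, 0), 0)) = 0 := by
      ext t; simp [raySlope]
    simp only [this, map_zero, add_zero] at h1
    exact h1

/-- Coordinates adapted to an integrable distribution of graphs: a local diffeomorphism `Θ` over
`W` whose `W`-slices are tangent to the graphs of `A`. -/
theorem exists_foliated_coordinates (A : X × W → W →L[ℝ] X) {Ω : Set (X × W)} (hΩ : IsOpen Ω)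
    (h0 : 0 ∈ Ω) (hA : ContDiffOn ℝ ∞ A Ω)
    (hint : ∀ q ∈ Ω, ∀ v w, fderiv ℝ A q (A q w, w) v = fderiv ℝ A q (A q v, v) w) :
    ∃ Θ : OpenPartialHomeomorph (X × W) (X × W), 0 ∈ Θ.source ∧ Θ 0 = 0 ∧ Θ.target ⊆ Ω ∧
      ContDiffOn ℝ ∞ Θ Θ.source ∧ ContDiffOn ℝ ∞ Θ.symm Θ.target ∧
      (∀ p ∈ Θ.source, (Θ p).2 = p.2) ∧
      ∀ p ∈ Θ.source, ∀ v, fderiv ℝ Θ p (0, v) = (A (Θ p) v, v) := by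
  -- `A` is cut off by a bump function, so as to be defined everywhere
  obtain ⟨r, hr, hball⟩ := Metric.isOpen_iff.1 hΩ 0 h0
  let χ : ContDiffBump (0 : X × W) := ⟨r / 4, r / 2, by positivity, by linarith⟩
  let A' : X × W → W →L[ℝ] X := fun q => χ q • A q
  have hA' : ContDiff ℝ ∞ A' := by
    refine contDiff_iff_contDiffAt.2 fun x => ?_
    by_cases hx : x ∈ tsupport A'
    swap
    · exact contDiffAt_const.congr_of_eventuallyEq (notMem_tsupport_iff_eventuallyEq.1 hx)
    have hx' : x ∈ tsupport χ := closure_mono (fun y hy => (smul_ne_zero_iff.1 hy).1) hx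
    rw [χ.tsupport_eq] at hx'
    exact χ.contDiffAt.smul (hA.contDiffAt (hΩ.mem_nhds (hball
      (Metric.closedBall_subset_ball (by simp only [χ]; linarith) hx'))))
  have hAA' : ∀ q ∈ Metric.ball (0 : X × W) (r / 4), A' =ᶠ[𝓝 q] A := fun q hq => by
    filter_upwards [Metric.isOpen_ball.mem_nhds hq] with y hy
    simp [A', χ.one_of_mem_closedBall (Metric.ball_subset_closedBall hy)]
  have hsub : Metric.ball (0 : X × W) (r / 4) ⊆ Ω :=
    (Metric.ball_subset_ball (by linarith)).trans hball
  obtain ⟨O, ζ, hO, h0O, hζ, hζ0, hζw, hζa⟩ := exists_family_of_integral_graphs A' hA'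
    (Metric.ball_mem_nhds 0 (by positivity : 0 < r / 4)) (fun q hq v w => by
      rw [(hAA' q hq).fderiv_eq, (hAA' q hq).eq_of_nhds]
      exact hint q (hsub hq) v w)
  let θ : X × W → X × W := fun p => (ζ p, p.2)
  have hθ : ContDiffOn ℝ ∞ θ O := hζ.prodMk contDiffOn_snd
  have hθd : ∀ p ∈ O, fderiv ℝ θ p = (fderiv ℝ ζ p).prod (ContinuousLinearMap.snd ℝ X W) :=
    fun p hp => ((((hζ.contDiffAt (hO.mem_nhds hp)).differentiableAt
      (by simp)).hasFDerivAt).prodMk hasFDerivAt_snd).fderiv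
  have hζ0a : ∀ a, fderiv ℝ ζ 0 (a, 0) = a := fun a => by
    have h1 : HasFDerivAt (fun a => ζ (a, (0 : W)))
        ((fderiv ℝ ζ 0).comp (ContinuousLinearMap.inl ℝ X W)) 0 :=
      HasFDerivAt.comp (0 : X) (g := ζ) ((hζ.contDiffAt (hO.mem_nhds h0O)).differentiableAt
        (by simp)).hasFDerivAt (hasFDerivAt_prodMk_left (0 : X) (0 : W))
    have h2 : HasFDerivAt (fun a => ζ (a, (0 : W))) (ContinuousLinearMap.id ℝ X) 0 := by
      refine (hasFDerivAt_id (0 : X)).congr_of_eventuallyEq ?_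
      filter_upwards [(hO.preimage (continuous_id.prodMk continuous_const)).mem_nhds h0O] with a ha
      exact hζa a ha
    simpa using congrArg (fun L => L a) (h1.unique h2)
  have hζ0' : ∀ a w, fderiv ℝ ζ 0 (a, w) = a + fderiv ℝ ζ 0 (0, w) := fun a w => by
    conv_rhs => rw [← hζ0a a, ← map_add]
    simp
  have hbij : Function.Bijective (fderiv ℝ θ 0) := by
    rw [hθd 0 h0O]
    constructor
    · rintro ⟨a, w⟩ ⟨a', w'⟩ h
      simp only [ContinuousLinearMap.prod_apply, ContinuousLinearMap.coe_snd', Prod.mk.injEq] at h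
      obtain ⟨h, rfl⟩ := h
      rw [hζ0' a w, hζ0' a' w] at h
      simp [add_right_cancel h]
    · rintro ⟨a, w⟩
      refine ⟨(a - fderiv ℝ ζ 0 (0, w), w), ?_⟩
      simp only [ContinuousLinearMap.prod_apply, ContinuousLinearMap.coe_snd', Prod.mk.injEq]
      exact ⟨by rw [hζ0']; abel, trivial⟩
  have hθ0 : θ 0 = 0 := Prod.ext hζ0 rfl
  have hO' := hθ.continuousOn.isOpen_inter_preimage hO (Metric.isOpen_ball (x := (0 : X × W))
    (ε := r / 4))
  obtain ⟨e, he, h0e, hes, hec, hesymm⟩ := exists_openPartialHomeomorph_of_bijective_fderiv hO'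
    (hθ.mono inter_subset_left) ⟨h0O, by simpa [hθ0] using hr⟩ hbij
  refine ⟨e, h0e, by rw [he, hθ0], fun y hy => ?_, hec, hesymm, fun p _ => by rw [he],
    fun p hp v => ?_⟩
  · have := (hes (e.map_target hy)).2
    rw [mem_preimage, ← he, e.right_inv hy] at this
    exact hsub this
  · have hpO := hes hp
    rw [he, hθd p hpO.1, ContinuousLinearMap.prod_apply, hζw p hpO.1]
    change (A' (θ p) v, v) = _
    rw [(hAA' _ hpO.2).eq_of_nhds]

end Frobenius

/-! ### Coordinate vector fields of a local parametrization -/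

section Param

variable {E : Type*} [NormedAddCommGroup E] [NormedSpace ℝ E] [FiniteDimensional ℝ E]
  {M : Type*} [TopologicalSpace M] [ChartedSpace E M] [IsManifold 𝓘(ℝ, E) ∞ M]
  {E₀ : Type*} [NormedAddCommGroup E₀] [NormedSpace ℝ E₀]

/-- `Ψ` is a smooth local parametrization of `M`: a diffeomorphism from an open subset of `E₀` onto
an open subset of `M`. -/
structure IsSmoothParam (E : Type*) [NormedAddCommGroup E] [NormedSpace ℝ E]
    {M : Type*} [TopologicalSpace M] [ChartedSpace E M]
    {E₀ : Type*} [NormedAddCommGroup E₀] [NormedSpace ℝ E₀]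
    (Ψ : OpenPartialHomeomorph E₀ M) : Prop where
  smooth : ContMDiffOn 𝓘(ℝ, E₀) 𝓘(ℝ, E) ∞ Ψ Ψ.source
  smooth_symm : ContMDiffOn 𝓘(ℝ, E) 𝓘(ℝ, E₀) ∞ Ψ.symm Ψ.target

variable (E) in
/-- The vector field on `M` that corresponds to the vector field `Z` on the parameter domain. It is
only meaningful on the target of `Ψ`. -/
def coordField (Ψ : OpenPartialHomeomorph E₀ M) (Z : E₀ → E₀) : Π x : M, TangentSpace 𝓘(ℝ, E) x :=
  VectorField.mpullback 𝓘(ℝ, E) 𝓘(ℝ, E₀) Ψ.symm Z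

variable {Ψ : OpenPartialHomeomorph E₀ M}

namespace IsSmoothParam

omit [FiniteDimensional ℝ E] [IsManifold 𝓘(ℝ, E) ∞ M] in
theorem mdifferentiable (hΨ : IsSmoothParam E Ψ) : Ψ.MDifferentiable 𝓘(ℝ, E₀) 𝓘(ℝ, E) :=
  ⟨hΨ.smooth.mdifferentiableOn (by simp), hΨ.smooth_symm.mdifferentiableOn (by simp)⟩

omit [FiniteDimensional ℝ E] [IsManifold 𝓘(ℝ, E) ∞ M] in
theorem mfderiv_bijective (hΨ : IsSmoothParam E Ψ) {q : E₀} (hq : q ∈ Ψ.source) :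
    Function.Bijective (mfderiv 𝓘(ℝ, E₀) 𝓘(ℝ, E) Ψ q) :=
  hΨ.mdifferentiable.mfderiv_bijective hq

omit [FiniteDimensional ℝ E] [IsManifold 𝓘(ℝ, E) ∞ M] in
theorem coordField_apply (hΨ : IsSmoothParam E Ψ) (Z : E₀ → E₀) {q : E₀} (hq : q ∈ Ψ.source) :
    coordField E Ψ Z (Ψ q) = mfderiv 𝓘(ℝ, E₀) 𝓘(ℝ, E) Ψ q (Z q) := by
  have h1 := hΨ.mdifferentiable.symm_comp_deriv hq
  have h2 := hΨ.mdifferentiable.comp_symm_deriv (Ψ.map_source hq)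
  rw [Ψ.left_inv hq] at h2
  have h3 : (mfderiv 𝓘(ℝ, E) 𝓘(ℝ, E₀) Ψ.symm (Ψ q)).inverse = mfderiv 𝓘(ℝ, E₀) 𝓘(ℝ, E) Ψ q :=
    ContinuousLinearMap.inverse_eq h1 h2
  change (mfderiv 𝓘(ℝ, E) 𝓘(ℝ, E₀) Ψ.symm (Ψ q)).inverse (Z (Ψ.symm (Ψ q))) = _
  rw [Ψ.left_inv hq]
  exact congrArg (fun L => L (Z q)) h3

omit [FiniteDimensional ℝ E] [IsManifold 𝓘(ℝ, E) ∞ M] in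
theorem isInvertible_mfderiv_symm (hΨ : IsSmoothParam E Ψ) {x : M} (hx : x ∈ Ψ.target) :
    (mfderiv 𝓘(ℝ, E) 𝓘(ℝ, E₀) Ψ.symm x).IsInvertible :=
  ⟨hΨ.mdifferentiable.symm.mfderiv hx, rfl⟩

theorem contMDiffAt_coordField (hΨ : IsSmoothParam E Ψ) {Z : E₀ → E₀} {q : E₀}
    (hq : q ∈ Ψ.source) (hZ : ContDiffAt ℝ ∞ Z q) :
    ContMDiffAt 𝓘(ℝ, E) (𝓘(ℝ, E).prod 𝓘(ℝ, E)) ∞ (T% (coordField E Ψ Z)) (Ψ q) := by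
  have : IsManifold 𝓘(ℝ, E) 1 M := .of_le (n := ∞) (by simp)
  refine ContMDiffAt.mpullback_vectorField_preimage (n := ∞) ?_
    (hΨ.smooth_symm.contMDiffAt (Ψ.open_target.mem_nhds (Ψ.map_source hq)))
    (hΨ.isInvertible_mfderiv_symm (Ψ.map_source hq)) (by simp)
  rw [Ψ.left_inv hq]
  exact contMDiffAt_vectorSpace_iff_contDiffAt.2 hZ

theorem mdiffAt_coordField (hΨ : IsSmoothParam E Ψ) {Z : E₀ → E₀} {q : E₀}
    (hq : q ∈ Ψ.source) (hZ : ContDiffAt ℝ ∞ Z q) : MDiffAt (T% (coordField E Ψ Z)) (Ψ q) :=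
  (hΨ.contMDiffAt_coordField hq hZ).mdifferentiableAt (by simp)

theorem mlieBracket_coordField [CompleteSpace E₀] (hΨ : IsSmoothParam E Ψ) {Z Z' : E₀ → E₀}
    {q : E₀} (hq : q ∈ Ψ.source) (hZ : ContDiffAt ℝ ∞ Z q) (hZ' : ContDiffAt ℝ ∞ Z' q) :
    VectorField.mlieBracket 𝓘(ℝ, E) (coordField E Ψ Z) (coordField E Ψ Z') (Ψ q)
      = mfderiv 𝓘(ℝ, E₀) 𝓘(ℝ, E) Ψ q (VectorField.lieBracket ℝ (E := E₀) Z Z' q) := by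
  have : IsManifold 𝓘(ℝ, E) (minSmoothness ℝ 3) M :=
    .of_le (n := ∞) (by simpa using ENat.LEInfty.out)
  have hd : ∀ {Z : E₀ → E₀}, ContDiffAt ℝ ∞ Z q →
      MDifferentiableAt 𝓘(ℝ, E₀) (𝓘(ℝ, E₀).prod 𝓘(ℝ, E₀))
        (fun y => (⟨y, Z y⟩ : TotalSpace E₀ (fun y : E₀ => TangentSpace 𝓘(ℝ, E₀) y)))
        (Ψ.symm (Ψ q)) := fun hZ => by
    rw [Ψ.left_inv hq]
    exact (contMDiffAt_vectorSpace_iff_contDiffAt.2 hZ).mdifferentiableAt (by simp)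
  have h := VectorField.mpullback_mlieBracket (n := ∞) (hd hZ) (hd hZ')
    (hΨ.smooth_symm.contMDiffAt (Ψ.open_target.mem_nhds (Ψ.map_source hq)))
    (by simpa using ENat.LEInfty.out)
  have hl : VectorField.mlieBracket 𝓘(ℝ, E₀) (M := E₀) Z Z'
      = VectorField.lieBracket ℝ (E := E₀) Z Z' :=
    VectorField.mlieBracketWithin_univ.symm.trans
      (VectorField.mlieBracketWithin_eq_lieBracketWithin.trans VectorField.lieBracketWithin_univ)
  rw [hl] at h
  exact h.symm.trans (hΨ.coordField_apply _ hq)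

omit [FiniteDimensional ℝ E] [IsManifold 𝓘(ℝ, E) ∞ M] in
theorem mvfderiv_apply_mfderiv (hΨ : IsSmoothParam E Ψ) {f : M → ℝ} {q : E₀} (hq : q ∈ Ψ.source)
    (hf : MDiffAt f (Ψ q)) (u : E₀) :
    mvfderiv 𝓘(ℝ, E) f (Ψ q) (mfderiv 𝓘(ℝ, E₀) 𝓘(ℝ, E) Ψ q u)
      = fderiv ℝ (fun q => f (Ψ q)) q u := by
  have h := mfderiv_comp q hf (hΨ.mdifferentiable.mdifferentiableAt hq)
  rw [← mfderiv_eq_fderiv]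
  exact (congrArg (fun L => L u) h).symm

end IsSmoothParam

variable [RiemannianBundle (fun x : M => TangentSpace 𝓘(ℝ, E) x)]

variable (E) in
/-- The coefficients of the metric of `M` in the local parametrization `Ψ`. -/
def coordMetric (Ψ : OpenPartialHomeomorph E₀ M) (q : E₀) : E₀ →L[ℝ] E₀ →L[ℝ] ℝ :=
  (innerSL ℝ (E := TangentSpace 𝓘(ℝ, E) (Ψ q))).bilinearComp
    (mfderiv 𝓘(ℝ, E₀) 𝓘(ℝ, E) Ψ q) (mfderiv 𝓘(ℝ, E₀) 𝓘(ℝ, E) Ψ q)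

omit [FiniteDimensional ℝ E] [IsManifold 𝓘(ℝ, E) ∞ M] in
theorem coordMetric_apply (Ψ : OpenPartialHomeomorph E₀ M) (q u u' : E₀) :
    coordMetric E Ψ q u u' = inner ℝ (mfderiv 𝓘(ℝ, E₀) 𝓘(ℝ, E) Ψ q u)
      (mfderiv 𝓘(ℝ, E₀) 𝓘(ℝ, E) Ψ q u') := rfl

omit [FiniteDimensional ℝ E] [IsManifold 𝓘(ℝ, E) ∞ M] in
theorem coordMetric_comm (Ψ : OpenPartialHomeomorph E₀ M) (q u u' : E₀) :
    coordMetric E Ψ q u u' = coordMetric E Ψ q u' u := by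
  rw [coordMetric_apply, coordMetric_apply, real_inner_comm]

variable [IsContMDiffRiemannianBundle 𝓘(ℝ, E) ∞ E (fun x : M => TangentSpace 𝓘(ℝ, E) x)]

namespace IsSmoothParam

theorem contDiffOn_coordMetric [FiniteDimensional ℝ E₀] (hΨ : IsSmoothParam E Ψ) :
    ContDiffOn ℝ ∞ (coordMetric E Ψ) Ψ.source := by
  rw [contDiffOn_clm_apply]
  intro u
  rw [contDiffOn_clm_apply]
  intro u' q hq
  have h1 := ContMDiffAt.inner_bundle (F := E) (E := fun x : M => TangentSpace 𝓘(ℝ, E) x)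
    (b := fun y : M => y) (hΨ.contMDiffAt_coordField hq (contDiffAt_const (c := u)))
    (hΨ.contMDiffAt_coordField hq (contDiffAt_const (c := u')))
  have h2 := h1.comp q (hΨ.smooth.contMDiffAt (Ψ.open_source.mem_nhds hq))
  refine (h2.contDiffAt.congr_of_eventuallyEq ?_).contDiffWithinAt
  filter_upwards [Ψ.open_source.mem_nhds hq] with q' hq'
  simp only [Function.comp_apply]
  rw [hΨ.coordField_apply _ hq', hΨ.coordField_apply _ hq', coordMetric_apply]

theorem mvfderiv_inner_coordField (hΨ : IsSmoothParam E Ψ) {q : E₀} (hq : q ∈ Ψ.source)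
    (u u' u'' : E₀) :
    mvfderiv 𝓘(ℝ, E) (fun y => inner ℝ (coordField E Ψ (fun _ => u) y)
        (coordField E Ψ (fun _ => u') y)) (Ψ q) (mfderiv 𝓘(ℝ, E₀) 𝓘(ℝ, E) Ψ q u'')
      = fderiv ℝ (fun q => coordMetric E Ψ q u u') q u'' := by
  rw [hΨ.mvfderiv_apply_mfderiv hq (mdiffAt_inner
    (hΨ.mdiffAt_coordField hq contDiffAt_const) (hΨ.mdiffAt_coordField hq contDiffAt_const))]
  congr 1
  refine Filter.EventuallyEq.fderiv_eq ?_
  filter_upwards [Ψ.open_source.mem_nhds hq] with q' hq'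
  rw [hΨ.coordField_apply _ hq', hΨ.coordField_apply _ hq', coordMetric_apply]

/-- The Koszul formula for coordinate vector fields, whose brackets vanish: the Christoffel symbols
of the first kind. -/
theorem inner_leviCivita_coordField [CompleteSpace E₀] (hΨ : IsSmoothParam E Ψ) {q : E₀}
    (hq : q ∈ Ψ.source) (u u' u'' : E₀) :
    inner ℝ (leviCivita E M (coordField E Ψ fun _ => u) (Ψ q)
        (mfderiv 𝓘(ℝ, E₀) 𝓘(ℝ, E) Ψ q u')) (mfderiv 𝓘(ℝ, E₀) 𝓘(ℝ, E) Ψ q u'')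
      = (1 / 2) * (fderiv ℝ (fun q => coordMetric E Ψ q u u'') q u'
        + fderiv ℝ (fun q => coordMetric E Ψ q u' u'') q u
        - fderiv ℝ (fun q => coordMetric E Ψ q u' u) q u'') := by
  have hd : ∀ u, MDiffAt (T% (coordField E Ψ fun _ => u)) (Ψ q) := fun u =>
    hΨ.mdiffAt_coordField hq contDiffAt_const
  have hb : ∀ u u', VectorField.mlieBracket 𝓘(ℝ, E) (coordField E Ψ fun _ => u)
      (coordField E Ψ fun _ => u') (Ψ q) = 0 := fun u u' => by
    rw [hΨ.mlieBracket_coordField hq contDiffAt_const contDiffAt_const]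
    simp only [VectorField.lieBracket_eq, fderiv_fun_const, Pi.zero_apply, zero_apply, sub_zero]
    exact map_zero _
  have h := inner_leviCivita (hd u') (hd u) (hd u'')
  simp only [koszul, hb, inner_zero_left, add_zero, sub_zero] at h
  rw [hΨ.coordField_apply _ hq, hΨ.coordField_apply _ hq, hΨ.coordField_apply _ hq,
    hΨ.mvfderiv_inner_coordField hq, hΨ.mvfderiv_inner_coordField hq,
    hΨ.mvfderiv_inner_coordField hq] at h
  exact h

end IsSmoothParam

end Param

/-! ### Totally geodesic distributions -/

section TotallyGeodesic

variable {E : Type*} [NormedAddCommGroup E] [NormedSpace ℝ E] [FiniteDimensional ℝ E]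
  {M : Type*} [TopologicalSpace M] [ChartedSpace E M] [IsManifold 𝓘(ℝ, E) ∞ M]
  [RiemannianBundle (fun x : M => TangentSpace 𝓘(ℝ, E) x)]
  [IsContMDiffRiemannianBundle 𝓘(ℝ, E) ∞ E (fun x : M => TangentSpace 𝓘(ℝ, E) x)]

/-- The distribution `D` is totally geodesic, with orthogonal complement `D'`: `∇_v Y` is orthogonal
to `D'` whenever `v` and `Y` are tangent to `D`. The orthogonality is tested on local sections `Z`
of `D'`. -/
def IsTotallyGeodesic (D D' : Π x : M, Submodule ℝ (TangentSpace 𝓘(ℝ, E) x)) : Prop :=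
  ∀ (p : M) (v : TangentSpace 𝓘(ℝ, E) p) (Y Z : Π x : M, TangentSpace 𝓘(ℝ, E) x), v ∈ D p →
    MDiffAt (T% Y) p → MDiffAt (T% Z) p → (∀ᶠ x in 𝓝 p, Y x ∈ D x) → (∀ᶠ x in 𝓝 p, Z x ∈ D' x) →
    inner ℝ (leviCivita E M Y p v) (Z p) = 0

/-- For orthogonal fields, `g(∇_v Y, Z) = -g(Y, ∇_v Z)`. Hence `g(∇_v Y, Z)` depends on `Y` and `Z`
only through their values at the point. -/
theorem inner_leviCivita_eq_neg {p : M} (v : TangentSpace 𝓘(ℝ, E) p)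
    {Y Z : Π x : M, TangentSpace 𝓘(ℝ, E) x} (hY : MDiffAt (T% Y) p) (hZ : MDiffAt (T% Z) p)
    (h : ∀ᶠ x in 𝓝 p, inner ℝ (Y x) (Z x) = 0) :
    inner ℝ (leviCivita E M Y p v) (Z p) = -inner ℝ (Y p) (leviCivita E M Z p v) := by
  have h1 := leviCivita_metric (X := FiberBundle.extend E v)
    (FiberBundle.mdifferentiableAt_extend ..) hY hZ
  have h2 : (fun y => (inner ℝ (Y y) (Z y) : ℝ)) =ᶠ[𝓝 p] fun _ => 0 := h
  have h3 : mvfderiv 𝓘(ℝ, E) (fun y => (inner ℝ (Y y) (Z y) : ℝ)) p = 0 := by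
    ext w
    rw [mvfderiv, h2.mfderiv_eq, mfderiv_const]
    rfl
  rw [h3] at h1
  simp only [FiberBundle.extend_apply_self, zero_apply] at h1
  linarith

variable {E₀ : Type*} [NormedAddCommGroup E₀] [NormedSpace ℝ E₀] [CompleteSpace E₀]
  {Ψ : OpenPartialHomeomorph E₀ M} {D D' : Π x : M, Submodule ℝ (TangentSpace 𝓘(ℝ, E) x)}

/-- The distribution `D` corresponds to the constant distribution `S` on the parameter domain. -/
def IsCoordDistribution (Ψ : OpenPartialHomeomorph E₀ M)
    (D : Π x : M, Submodule ℝ (TangentSpace 𝓘(ℝ, E) x)) (S : Submodule ℝ E₀) : Prop :=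
  ∀ q ∈ Ψ.source, ∀ w, w ∈ D (Ψ q) ↔ ∃ u ∈ S, w = mfderiv 𝓘(ℝ, E₀) 𝓘(ℝ, E) Ψ q u

omit [FiniteDimensional ℝ E] [RiemannianBundle (fun x : M => TangentSpace 𝓘(ℝ, E) x)]
  [IsContMDiffRiemannianBundle 𝓘(ℝ, E) ∞ E (fun x : M => TangentSpace 𝓘(ℝ, E) x)]
  [IsManifold 𝓘(ℝ, E) ∞ M] [CompleteSpace E₀] in
theorem IsCoordDistribution.eventually_coordField_mem {S : Submodule ℝ E₀}
    (hD : IsCoordDistribution Ψ D S) (hΨ : IsSmoothParam E Ψ) {q : E₀} (hq : q ∈ Ψ.source)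
    {u : E₀} (hu : u ∈ S) : ∀ᶠ x in 𝓝 (Ψ q), coordField E Ψ (fun _ => u) x ∈ D x := by
  filter_upwards [Ψ.open_target.mem_nhds (Ψ.map_source hq)] with x hx
  rw [← Ψ.right_inv hx, hD _ (Ψ.map_target hx)]
  exact ⟨u, hu, hΨ.coordField_apply _ (Ψ.map_target hx)⟩

omit [FiniteDimensional ℝ E] [IsManifold 𝓘(ℝ, E) ∞ M] [CompleteSpace E₀]
  [IsContMDiffRiemannianBundle 𝓘(ℝ, E) ∞ E (fun x : M => TangentSpace 𝓘(ℝ, E) x)] in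
theorem fderiv_coordMetric_eq_zero {S S' : Submodule ℝ E₀} (hD : IsCoordDistribution Ψ D S)
    (hD' : IsCoordDistribution Ψ D' S') (horth : ∀ x, D x ⟂ D' x) {q : E₀} (hq : q ∈ Ψ.source)
    {u u' : E₀} (hu : u ∈ S) (hu' : u' ∈ S') :
    fderiv ℝ (fun q => coordMetric E Ψ q u u') q = 0 := by
  have : (fun q => coordMetric E Ψ q u u') =ᶠ[𝓝 q] fun _ => 0 := by
    filter_upwards [Ψ.open_source.mem_nhds hq] with q hq
    exact (horth _).inner_eq ((hD q hq _).2 ⟨u, hu, rfl⟩) ((hD' q hq _).2 ⟨u', hu', rfl⟩)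
  rw [this.fderiv_eq, fderiv_fun_const]
  rfl

/-- If the metric coefficients on the leaves of `D` do not depend on the transverse coordinates, then
`D` is totally geodesic. -/
theorem inner_leviCivita_eq_zero_of_fderiv_coordMetric {S S' : Submodule ℝ E₀}
    (hΨ : IsSmoothParam E Ψ) (hD : IsCoordDistribution Ψ D S) (hD' : IsCoordDistribution Ψ D' S')
    (horth : ∀ x, D x ⟂ D' x) {q : E₀} (hq : q ∈ Ψ.source)
    (hG : ∀ u ∈ S, ∀ u' ∈ S, ∀ u'' ∈ S', fderiv ℝ (fun q => coordMetric E Ψ q u u') q u'' = 0)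
    {v : TangentSpace 𝓘(ℝ, E) (Ψ q)} {Y Z : Π x : M, TangentSpace 𝓘(ℝ, E) x} (hv : v ∈ D (Ψ q))
    (hY : MDiffAt (T% Y) (Ψ q)) (hYD : ∀ᶠ x in 𝓝 (Ψ q), Y x ∈ D x)
    (hZD : ∀ᶠ x in 𝓝 (Ψ q), Z x ∈ D' x) :
    inner ℝ (leviCivita E M Y (Ψ q) v) (Z (Ψ q)) = 0 := by
  obtain ⟨u', hu', rfl⟩ := (hD q hq v).1 hv
  obtain ⟨u, hu, hYu⟩ := (hD q hq _).1 hYD.self_of_nhds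
  obtain ⟨u'', hu'', hZu⟩ := (hD' q hq _).1 hZD.self_of_nhds
  have h1 := inner_leviCivita_eq_neg (mfderiv 𝓘(ℝ, E₀) 𝓘(ℝ, E) Ψ q u') hY
    (hΨ.mdiffAt_coordField hq (contDiffAt_const (c := u''))) (by
      filter_upwards [hYD, hD'.eventually_coordField_mem hΨ hq hu''] with x hx hx'
      exact (horth x).inner_eq hx hx')
  rw [hΨ.coordField_apply _ hq] at h1
  rw [hZu, h1, hYu, real_inner_comm, hΨ.inner_leviCivita_coordField hq, hG u' hu' u hu u'' hu'',
    fderiv_coordMetric_eq_zero hD hD' horth hq hu' hu'',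
    fderiv_coordMetric_eq_zero hD' hD (fun x => (horth x).symm) hq hu'' hu]
  simp

/-- Along a totally geodesic distribution, the metric coefficients on the leaves do not depend on
the transverse coordinates. -/
theorem IsTotallyGeodesic.fderiv_coordMetric {S S' : Submodule ℝ E₀}
    (htg : IsTotallyGeodesic D D') (hΨ : IsSmoothParam E Ψ) (hD : IsCoordDistribution Ψ D S)
    (hD' : IsCoordDistribution Ψ D' S') (horth : ∀ x, D x ⟂ D' x) {q : E₀} (hq : q ∈ Ψ.source)
    {u u' u'' : E₀} (hu : u ∈ S) (hu' : u' ∈ S) (hu'' : u'' ∈ S') :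
    fderiv ℝ (fun q => coordMetric E Ψ q u u') q u'' = 0 := by
  have hd : ∀ u, MDiffAt (T% (coordField E Ψ fun _ => u)) (Ψ q) := fun u =>
    hΨ.mdiffAt_coordField hq contDiffAt_const
  have h1 := hΨ.inner_leviCivita_coordField hq u'' u u'
  have h2 := htg (Ψ q) _ _ _ ((hD q hq _).2 ⟨u, hu, rfl⟩) (hd u') (hd u'')
    (hD.eventually_coordField_mem hΨ hq hu') (hD'.eventually_coordField_mem hΨ hq hu'')
  rw [inner_leviCivita_eq_neg _ (hd u') (hd u'') (by
      filter_upwards [hD.eventually_coordField_mem hΨ hq hu',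
        hD'.eventually_coordField_mem hΨ hq hu''] with x hx hx'
      exact (horth x).inner_eq hx hx'), neg_eq_zero, real_inner_comm,
    hΨ.coordField_apply _ hq] at h2
  rw [h2, fderiv_coordMetric_eq_zero hD' hD (fun x => (horth x).symm) hq hu'' hu',
    fderiv_coordMetric_eq_zero hD hD' horth hq hu hu''] at h1
  simpa using h1.symm

/-- A totally geodesic distribution is involutive. -/
theorem IsTotallyGeodesic.inner_mlieBracket (htg : IsTotallyGeodesic D D') {p : M}
    {X Y Z : Π x : M, TangentSpace 𝓘(ℝ, E) x} (hX : MDiffAt (T% X) p) (hY : MDiffAt (T% Y) p)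
    (hZ : MDiffAt (T% Z) p) (hXD : ∀ᶠ x in 𝓝 p, X x ∈ D x) (hYD : ∀ᶠ x in 𝓝 p, Y x ∈ D x)
    (hZD : ∀ᶠ x in 𝓝 p, Z x ∈ D' x) :
    inner ℝ (VectorField.mlieBracket 𝓘(ℝ, E) X Y p) (Z p) = 0 := by
  have h := ((leviCivita E M).torsion_eq_zero_iff.1 leviCivita_torsion) hX hY
  rw [← h, inner_sub_left, htg p _ _ _ hXD.self_of_nhds hY hZ hYD hZD,
    htg p _ _ _ hYD.self_of_nhds hX hZ hXD hZD, sub_zero]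

end TotallyGeodesic

/-! ### A Riemannian product has totally geodesic factors -/

section Product

variable {E : Type*} [NormedAddCommGroup E] [NormedSpace ℝ E] [FiniteDimensional ℝ E]
  {M : Type*} [TopologicalSpace M] [ChartedSpace E M] [IsManifold 𝓘(ℝ, E) ∞ M]
  [RiemannianBundle (fun x : M => TangentSpace 𝓘(ℝ, E) x)]
  [IsContMDiffRiemannianBundle 𝓘(ℝ, E) ∞ E (fun x : M => TangentSpace 𝓘(ℝ, E) x)]
  {D₁ D₂ : Π x : M, Submodule ℝ (TangentSpace 𝓘(ℝ, E) x)}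

theorem mem_range_inl {E₁ E₂ : Type*} [NormedAddCommGroup E₁] [NormedSpace ℝ E₁]
    [NormedAddCommGroup E₂] [NormedSpace ℝ E₂] (P : E₁ × E₂ → Prop) :
    (∃ q ∈ LinearMap.range (LinearMap.inl ℝ E₁ E₂), P q) ↔ ∃ u, P (u, 0) := by
  simp

theorem mem_range_inr {E₁ E₂ : Type*} [NormedAddCommGroup E₁] [NormedSpace ℝ E₁]
    [NormedAddCommGroup E₂] [NormedSpace ℝ E₂] (P : E₁ × E₂ → Prop) :
    (∃ q ∈ LinearMap.range (LinearMap.inr ℝ E₁ E₂), P q) ↔ ∃ v, P (0, v) := by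
  simp

/-- The factors of a local Riemannian product are totally geodesic: each block of the product metric
does not depend on the coordinates of the other factor. -/
theorem IsLocallyRiemannianProduct.isTotallyGeodesic (h : IsLocallyRiemannianProduct D₁ D₂)
    (horth : ∀ x, D₁ x ⟂ D₂ x) : IsTotallyGeodesic D₁ D₂ ∧ IsTotallyGeodesic D₂ D₁ := by
  have key : ∀ p : M, (∀ (v : TangentSpace 𝓘(ℝ, E) p) (Y Z : Π x : M, TangentSpace 𝓘(ℝ, E) x),
      v ∈ D₁ p → MDiffAt (T% Y) p → MDiffAt (T% Z) p → (∀ᶠ x in 𝓝 p, Y x ∈ D₁ x) →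
      (∀ᶠ x in 𝓝 p, Z x ∈ D₂ x) → inner ℝ (leviCivita E M Y p v) (Z p) = 0) ∧
      (∀ (v : TangentSpace 𝓘(ℝ, E) p) (Y Z : Π x : M, TangentSpace 𝓘(ℝ, E) x),
      v ∈ D₂ p → MDiffAt (T% Y) p → MDiffAt (T% Z) p → (∀ᶠ x in 𝓝 p, Y x ∈ D₂ x) →
      (∀ᶠ x in 𝓝 p, Z x ∈ D₁ x) → inner ℝ (leviCivita E M Y p v) (Z p) = 0) := by
    intro p
    obtain ⟨k, l, U₁, U₂, g₁, g₂, Ψ, hU₁, -, -, hU₂, -, -, hsrc, hp, hΨs, hΨt, hprod⟩ := h p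
    have hΨ : IsSmoothParam E Ψ := ⟨hΨs, hΨt⟩
    obtain ⟨q, hq, rfl⟩ : ∃ q ∈ Ψ.source, Ψ q = p :=
      ⟨Ψ.symm p, Ψ.map_target hp, Ψ.right_inv hp⟩
    have hG : ∀ q ∈ Ψ.source, ∀ u v u' v', coordMetric E Ψ q (u, v) (u', v')
        = g₁ q.1 u u' + g₂ q.2 v v' := by
      rintro ⟨a, b⟩ hab u v u' v'
      rw [hsrc] at hab
      exact (hprod a hab.1 b hab.2).1 u u' v v'
    have hD₁ : IsCoordDistribution Ψ D₁ (LinearMap.range (LinearMap.inl ℝ _ _)) := by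
      rintro ⟨a, b⟩ hab w
      rw [hsrc] at hab
      rw [mem_range_inl]
      exact (hprod a hab.1 b hab.2).2.1 w
    have hD₂ : IsCoordDistribution Ψ D₂ (LinearMap.range (LinearMap.inr ℝ _ _)) := by
      rintro ⟨a, b⟩ hab w
      rw [hsrc] at hab
      rw [mem_range_inr]
      exact (hprod a hab.1 b hab.2).2.2 w
    obtain ⟨a, b⟩ := q
    have hqU : (a, b) ∈ U₁ ×ˢ U₂ := hsrc ▸ hq
    have hdiff : ∀ w w', DifferentiableAt ℝ (fun q => coordMetric E Ψ q w w') (a, b) :=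
      fun w w' => (((hΨ.contDiffOn_coordMetric.contDiffAt (Ψ.open_source.mem_nhds hq)).clm_apply
        contDiffAt_const).clm_apply contDiffAt_const).differentiableAt (by simp)
    constructor
    · intro v Y Z hv hY _ hYD hZD
      refine inner_leviCivita_eq_zero_of_fderiv_coordMetric hΨ hD₁ hD₂ horth hq ?_ hv hY hYD hZD
      rintro _ ⟨u, rfl⟩ _ ⟨u', rfl⟩ _ ⟨v, rfl⟩
      have h1 : HasFDerivAt (fun y => coordMetric E Ψ (a, y) (u, 0) (u', 0))
          ((fderiv ℝ (fun q => coordMetric E Ψ q (u, 0) (u', 0)) (a, b)).comp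
            (ContinuousLinearMap.inr ℝ _ _)) b :=
        HasFDerivAt.comp b (g := fun q => coordMetric E Ψ q (u, 0) (u', 0))
          (hdiff _ _).hasFDerivAt (hasFDerivAt_prodMk_right a b)
      have h2 : (fun y => coordMetric E Ψ (a, y) (u, 0) (u', 0)) =ᶠ[𝓝 b] fun _ => g₁ a u u' := by
        filter_upwards [hU₂.mem_nhds hqU.2] with y hy
        rw [hG (a, y) (hsrc ▸ ⟨hqU.1, hy⟩)]
        simp
      simpa using congrArg (fun L => L v) (h1.unique
        ((hasFDerivAt_const (g₁ a u u') b).congr_of_eventuallyEq h2))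
    · intro v Y Z hv hY _ hYD hZD
      refine inner_leviCivita_eq_zero_of_fderiv_coordMetric hΨ hD₂ hD₁ (fun x => (horth x).symm)
        hq ?_ hv hY hYD hZD
      rintro _ ⟨u, rfl⟩ _ ⟨u', rfl⟩ _ ⟨v, rfl⟩
      have h1 : HasFDerivAt (fun y => coordMetric E Ψ (y, b) (0, u) (0, u'))
          ((fderiv ℝ (fun q => coordMetric E Ψ q (0, u) (0, u')) (a, b)).comp
            (ContinuousLinearMap.inl ℝ _ _)) a :=
        HasFDerivAt.comp a (g := fun q => coordMetric E Ψ q (0, u) (0, u'))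
          (hdiff _ _).hasFDerivAt (hasFDerivAt_prodMk_left a b)
      have h2 : (fun y => coordMetric E Ψ (y, b) (0, u) (0, u')) =ᶠ[𝓝 a] fun _ => g₂ b u u' := by
        filter_upwards [hU₁.mem_nhds hqU.1] with y hy
        rw [hG (y, b) (hsrc ▸ ⟨hy, hqU.2⟩)]
        simp
      simpa using congrArg (fun L => L v) (h1.unique
        ((hasFDerivAt_const (g₂ b u u') a).congr_of_eventuallyEq h2))
  exact ⟨fun p => (key p).1, fun p => (key p).2⟩

end Product

/-! ### Coordinates adapted to a submersion -/

section SubmersionCoordinates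

variable {E : Type*} [NormedAddCommGroup E] [NormedSpace ℝ E] [FiniteDimensional ℝ E]
  {M : Type*} [TopologicalSpace M] [ChartedSpace E M] [IsManifold 𝓘(ℝ, E) ∞ M]
  {E' : Type*} [NormedAddCommGroup E'] [NormedSpace ℝ E'] [FiniteDimensional ℝ E']
  {N : Type*} [TopologicalSpace N] [ChartedSpace E' N] [IsManifold 𝓘(ℝ, E') ∞ N]

omit [FiniteDimensional ℝ E] [IsManifold 𝓘(ℝ, E) ∞ M] in
theorem IsSmoothParam.trans {E₀ E₁ : Type*} [NormedAddCommGroup E₀] [NormedSpace ℝ E₀]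
    [NormedAddCommGroup E₁] [NormedSpace ℝ E₁] {Θ : OpenPartialHomeomorph E₁ E₀}
    {Ψ : OpenPartialHomeomorph E₀ M} (hΨ : IsSmoothParam E Ψ) (hΘ : ContDiffOn ℝ ∞ Θ Θ.source)
    (hΘ' : ContDiffOn ℝ ∞ Θ.symm Θ.target) : IsSmoothParam E (Θ.trans Ψ) where
  smooth := hΨ.smooth.comp (hΘ.contMDiffOn.mono fun _ hx => hx.1) fun _ hx => hx.2
  smooth_symm := hΘ'.contMDiffOn.comp (hΨ.smooth_symm.mono fun _ hx => hx.1) fun _ hx => hx.2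

omit [FiniteDimensional ℝ E] in
theorem isSmoothParam_chartAt_symm (p : M) : IsSmoothParam E (chartAt E p).symm :=
  ⟨contMDiffOn_chart_symm, contMDiffOn_chart⟩

/-- Around every point, a submersion is a linear projection in suitable coordinates. Only the
resulting description of its vertical distribution is recorded. -/
theorem exists_param_of_submersion {F : M → N} (hF : ContMDiff 𝓘(ℝ, E) 𝓘(ℝ, E') ∞ F) (p : M)
    (hsurj : Function.Surjective (mfderiv 𝓘(ℝ, E) 𝓘(ℝ, E') F p)) :
    ∃ (k l : ℕ) (Ψ : OpenPartialHomeomorph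
        (EuclideanSpace ℝ (Fin k) × EuclideanSpace ℝ (Fin l)) M),
      IsSmoothParam E Ψ ∧ 0 ∈ Ψ.source ∧ Ψ 0 = p ∧
      IsCoordDistribution Ψ (vertical E E' F) (LinearMap.range (LinearMap.inl ℝ _ _)) := by
  set c := chartAt E p
  set cN := chartAt E' (F p)
  set x₀ : E := c p
  have hpc : p ∈ c.source := mem_chart_source E p
  have hcN : F p ∈ cN.source := mem_chart_source E' (F p)
  have hx₀ : c.symm x₀ = p := c.left_inv hpc
  let f : E → E' := fun x => cN (F (c.symm x))
  let O : Set E := c.target ∩ c.symm ⁻¹' (F ⁻¹' cN.source)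
  have hO : IsOpen O := c.isOpen_inter_preimage_symm (cN.open_source.preimage hF.continuous)
  have hx₀O : x₀ ∈ O := ⟨c.map_source hpc, by simpa [hx₀] using hcN⟩
  have hf : ContDiffOn ℝ ∞ f O := by
    rw [← contMDiffOn_iff_contDiffOn]
    exact (contMDiffOn_chart (I := 𝓘(ℝ, E')) (n := ∞)).comp
      (hF.comp_contMDiffOn (contMDiffOn_chart_symm.mono inter_subset_left)) fun x hx => hx.2
  have hcNd := mdifferentiable_chart (I := 𝓘(ℝ, E')) (F p)
  have hcd := mdifferentiable_chart (I := 𝓘(ℝ, E)) p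
  have hFd : ∀ x, MDifferentiableAt 𝓘(ℝ, E) 𝓘(ℝ, E') F x := fun x =>
    hF.mdifferentiable (by simp) x
  have hfd : Function.Surjective (fderiv ℝ f x₀) := by
    have h1 : MDifferentiableAt 𝓘(ℝ, E) 𝓘(ℝ, E) c.symm x₀ :=
      hcd.symm.mdifferentiableAt hx₀O.1
    have h2 : mfderiv 𝓘(ℝ, E) 𝓘(ℝ, E') f x₀ = (mfderiv 𝓘(ℝ, E') 𝓘(ℝ, E') cN (F (c.symm x₀))).comp
        ((mfderiv 𝓘(ℝ, E) 𝓘(ℝ, E') F (c.symm x₀)).comp (mfderiv 𝓘(ℝ, E) 𝓘(ℝ, E) c.symm x₀)) := by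
      rw [← mfderiv_comp x₀ (hFd _) h1]
      exact mfderiv_comp x₀ (hcNd.mdifferentiableAt hx₀O.2) ((hFd _).comp x₀ h1)
    rw [← mfderiv_eq_fderiv, h2]
    have h3 : Function.Surjective (mfderiv 𝓘(ℝ, E) 𝓘(ℝ, E') F (c.symm x₀)) := by
      rw [hx₀]; exact hsurj
    exact (hcNd.mfderiv_surjective hx₀O.2).comp (h3.comp (hcd.symm.mfderiv_surjective hx₀O.1))
  -- a linear projection onto the kernel completes the derivative to an isomorphism
  let K : Submodule ℝ E := LinearMap.ker (fderiv ℝ f x₀).toLinearMap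
  obtain ⟨pr₀, hpr₀⟩ := K.subtype.exists_leftInverse_of_injective K.ker_subtype
  let pr : E →L[ℝ] K := LinearMap.toContinuousLinearMap pr₀
  have hpr : ∀ x : K, pr x = x := fun x => congrArg (fun L => L x) hpr₀
  let e₁ : K ≃L[ℝ] EuclideanSpace ℝ (Fin (Module.finrank ℝ K)) :=
    ContinuousLinearEquiv.ofFinrankEq (by simp)
  let e₂ : E' ≃L[ℝ] EuclideanSpace ℝ (Fin (Module.finrank ℝ E')) :=
    ContinuousLinearEquiv.ofFinrankEq (by simp)
  let f₁ : E → EuclideanSpace ℝ (Fin (Module.finrank ℝ K)) := fun x => e₁ (pr (x - x₀))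
  let f₂ : E → EuclideanSpace ℝ (Fin (Module.finrank ℝ E')) := fun x => e₂ (f x - f x₀)
  have hf₁ : ContDiff ℝ ∞ f₁ :=
    e₁.contDiff.comp (pr.contDiff.comp (contDiff_id.sub contDiff_const))
  have hf₂ : ContDiffOn ℝ ∞ f₂ O := e₂.contDiff.comp_contDiffOn (hf.sub contDiffOn_const)
  have hf₁d : HasFDerivAt f₁ ((e₁ : K →L[ℝ] _).comp pr) x₀ :=
    ((e₁ : K →L[ℝ] EuclideanSpace ℝ (Fin (Module.finrank ℝ K))).comp pr).hasFDerivAt.comp x₀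
      ((hasFDerivAt_id x₀).sub_const x₀)
  have hf₂d : HasFDerivAt f₂ ((e₂ : E' →L[ℝ] _).comp (fderiv ℝ f x₀)) x₀ :=
    e₂.hasFDerivAt.comp x₀ ((((hf.contDiffAt (hO.mem_nhds hx₀O)).differentiableAt
      (by simp)).hasFDerivAt).sub_const (f x₀))
  have hbij : Function.Bijective (fderiv ℝ (fun x => (f₁ x, f₂ x)) x₀) := by
    rw [(hf₁d.prodMk hf₂d).fderiv]
    constructor
    · rw [injective_iff_map_eq_zero]
      intro x hx
      simp only [ContinuousLinearMap.prod_apply, ContinuousLinearMap.comp_apply,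
        ContinuousLinearEquiv.coe_coe, Prod.mk_eq_zero, EmbeddingLike.map_eq_zero_iff] at hx
      have hxK : x ∈ K := hx.2
      have := hpr ⟨x, hxK⟩
      simp only [hx.1] at this
      exact (congrArg Subtype.val this).symm
    · rintro ⟨a, b⟩
      obtain ⟨y, hy⟩ := hfd (e₂.symm b)
      refine ⟨y + ((e₁.symm a - pr y : K) : E), ?_⟩
      have h1 : fderiv ℝ f x₀ ((e₁.symm a - pr y : K) : E) = 0 := (e₁.symm a - pr y).2
      simp only [ContinuousLinearMap.prod_apply, ContinuousLinearMap.comp_apply,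
        ContinuousLinearEquiv.coe_coe, map_add, hpr, h1, hy]
      simp
  obtain ⟨e, he, hxe, heO, hes, het⟩ := exists_openPartialHomeomorph_of_bijective_fderiv hO
    (hf₁.contDiffOn.prodMk hf₂) hx₀O hbij
  have he0 : e x₀ = 0 := by rw [he]; simp [f₁, f₂]
  let Ψ := e.symm.trans c.symm
  have hΨ : IsSmoothParam E Ψ :=
    (isSmoothParam_chartAt_symm p).trans het (by simpa using hes)
  have hΨ0 : Ψ 0 = p := by
    rw [← he0]
    simp [Ψ, e.left_inv hxe, hx₀]
  refine ⟨_, _, Ψ, hΨ, ?_, hΨ0, ?_⟩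
  · refine ⟨?_, ?_⟩
    · rw [← he0]; exact e.map_source hxe
    · change e.symm 0 ∈ c.target
      rw [← he0, e.left_inv hxe]
      exact hx₀O.1
  -- in these coordinates, `F` followed by a chart of `N` is the second projection
  intro q hq w
  let h : N → EuclideanSpace ℝ (Fin (Module.finrank ℝ E')) := fun y => e₂ (cN y - f x₀)
  have hqO : ∀ q ∈ Ψ.source, F (Ψ q) ∈ cN.source := fun q hq => (heO (e.map_target hq.1)).2
  have hsnd : ∀ q ∈ Ψ.source, h (F (Ψ q)) = q.2 := by
    intro q hq
    have := congrArg Prod.snd (e.right_inv hq.1)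
    rw [he] at this
    exact this
  have hhd : ∀ y ∈ cN.source,
      MDifferentiableAt 𝓘(ℝ, E') 𝓘(ℝ, EuclideanSpace ℝ (Fin (Module.finrank ℝ E'))) h y ∧
      Function.Injective
        (mfderiv 𝓘(ℝ, E') 𝓘(ℝ, EuclideanSpace ℝ (Fin (Module.finrank ℝ E'))) h y) := by
    intro y hy
    have h1 : HasFDerivAt (fun z => e₂ (z - f x₀)) (e₂ : E' →L[ℝ] _) (cN y) :=
      e₂.hasFDerivAt.comp (cN y) ((hasFDerivAt_id _).sub_const _)
    have h2 := h1.hasMFDerivAt.comp y (hcNd.mdifferentiableAt hy).hasMFDerivAt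
    refine ⟨h2.mdifferentiableAt, ?_⟩
    rw [HasMFDerivAt.mfderiv (f := h) h2]
    exact e₂.injective.comp (hcNd.mfderiv_injective hy)
  obtain ⟨⟨u, v⟩, huv⟩ := (hΨ.mfderiv_bijective hq).2 w
  have hΨd := hΨ.mdifferentiable.mdifferentiableAt hq
  have hchain : mfderiv 𝓘(ℝ, E') 𝓘(ℝ, EuclideanSpace ℝ (Fin (Module.finrank ℝ E'))) h (F (Ψ q))
      (mfderiv 𝓘(ℝ, E) 𝓘(ℝ, E') F (Ψ q) (mfderiv 𝓘(ℝ, _) 𝓘(ℝ, E) Ψ q (u, v))) = v := by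
    have h1 := (hhd _ (hqO q hq)).1.hasMFDerivAt.comp q
      ((hFd (Ψ q)).hasMFDerivAt.comp q hΨd.hasMFDerivAt)
    have h2 : (h ∘ F ∘ Ψ) =ᶠ[𝓝 q] Prod.snd := by
      filter_upwards [Ψ.open_source.mem_nhds hq] with q hq using hsnd q hq
    have h3 := congrArg (fun L => L (u, v)) (h1.mfderiv.symm.trans h2.mfderiv_eq)
    refine h3.trans ?_
    rw [mfderiv_eq_fderiv, fderiv_snd]
    rfl
  have hker : mfderiv 𝓘(ℝ, _) 𝓘(ℝ, E) Ψ q (u, v) ∈ vertical E E' F (Ψ q) ↔ v = 0 := by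
    constructor
    · intro hw
      have hw' : mfderiv 𝓘(ℝ, E) 𝓘(ℝ, E') F (Ψ q) (mfderiv 𝓘(ℝ, _) 𝓘(ℝ, E) Ψ q (u, v)) = 0 := hw
      rw [← hchain, hw']
      exact map_zero _
    · intro hv
      refine (hhd _ (hqO q hq)).2 ?_
      rw [map_zero]
      exact hchain.trans hv
  rw [← huv]
  refine hker.trans (Iff.trans ?_ (mem_range_inl (fun z => mfderiv 𝓘(ℝ, _) 𝓘(ℝ, E) Ψ q (u, v)
    = mfderiv 𝓘(ℝ, _) 𝓘(ℝ, E) Ψ q z)).symm)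
  constructor
  · rintro rfl; exact ⟨u, rfl⟩
  · rintro ⟨u', hu'⟩
    exact congrArg Prod.snd ((hΨ.mfderiv_bijective hq).1 hu')

end SubmersionCoordinates

/-! ### Orthogonal totally geodesic foliations split the manifold -/

section Splitting

variable {E : Type*} [NormedAddCommGroup E] [NormedSpace ℝ E] [FiniteDimensional ℝ E]
  {M : Type*} [TopologicalSpace M] [ChartedSpace E M] [IsManifold 𝓘(ℝ, E) ∞ M]
  [RiemannianBundle (fun x : M => TangentSpace 𝓘(ℝ, E) x)]
  [IsContMDiffRiemannianBundle 𝓘(ℝ, E) ∞ E (fun x : M => TangentSpace 𝓘(ℝ, E) x)]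
  {X W : Type*} [NormedAddCommGroup X] [NormedSpace ℝ X] [FiniteDimensional ℝ X]
  [NormedAddCommGroup W] [NormedSpace ℝ W] [FiniteDimensional ℝ W]
  {Ψ : OpenPartialHomeomorph (X × W) M}
  {D D' : Π x : M, Submodule ℝ (TangentSpace 𝓘(ℝ, E) x)}

theorem isInvertible_of_posDef {X : Type*} [NormedAddCommGroup X] [NormedSpace ℝ X]
    [FiniteDimensional ℝ X] (B : X →L[ℝ] X →L[ℝ] ℝ) (hB : ∀ u, u ≠ 0 → 0 < B u u) :
    B.IsInvertible := by
  have hinj : Function.Injective B.toLinearMap := by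
    rw [injective_iff_map_eq_zero]
    intro u hu
    by_contra h
    have h1 := hB u h
    have h2 : B u = 0 := hu
    simp [h2] at h1
  have hfr : Module.finrank ℝ X = Module.finrank ℝ (X →L[ℝ] ℝ) := by
    rw [← Subspace.dual_finrank_eq (K := ℝ) (V := X)]
    exact (LinearMap.toContinuousLinearMap (𝕜 := ℝ) (E := X) (F' := ℝ)).finrank_eq
  have hsurj := (LinearMap.injective_iff_surjective_of_finrank_eq_finrank hfr).1 hinj
  exact ⟨ContinuousLinearEquiv.ofBijective B (LinearMap.ker_eq_bot.2 hinj)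
    (LinearMap.range_eq_top.2 hsurj), ContinuousLinearEquiv.coe_ofBijective _ _ _⟩

omit [FiniteDimensional ℝ E] [IsManifold 𝓘(ℝ, E) ∞ M]
  [IsContMDiffRiemannianBundle 𝓘(ℝ, E) ∞ E (fun x : M => TangentSpace 𝓘(ℝ, E) x)] in
theorem coordMetric_pos {E₀ : Type*} [NormedAddCommGroup E₀] [NormedSpace ℝ E₀]
    {Ψ : OpenPartialHomeomorph E₀ M} (hΨ : IsSmoothParam E Ψ) {q : E₀} (hq : q ∈ Ψ.source) {u : E₀}
    (hu : u ≠ 0) : 0 < coordMetric E Ψ q u u := by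
  rw [coordMetric_apply, real_inner_self_pos]
  intro h
  exact hu ((hΨ.mfderiv_bijective hq).1 (h.trans (map_zero _).symm))

/-- The orthogonal complement of a coordinate distribution is a smooth family of graphs. -/
theorem exists_graph_orthogonal (hΨ : IsSmoothParam E Ψ)
    (hD : IsCoordDistribution Ψ D (LinearMap.range (LinearMap.inl ℝ X W)))
    (hD' : ∀ x, D' x = (D x)ᗮ) :
    ∃ A : X × W → W →L[ℝ] X, ContDiffOn ℝ ∞ A Ψ.source ∧
      ∀ q ∈ Ψ.source, ∀ w, mfderiv 𝓘(ℝ, X × W) 𝓘(ℝ, E) Ψ q (A q w, w) ∈ D' (Ψ q) := by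
  let G := coordMetric E Ψ
  have hG : ContDiffOn ℝ ∞ G Ψ.source := hΨ.contDiffOn_coordMetric
  let g₁ : X × W → X →L[ℝ] X →L[ℝ] ℝ := fun q =>
    (G q).bilinearComp (ContinuousLinearMap.inl ℝ X W) (ContinuousLinearMap.inl ℝ X W)
  let g₂ : X × W → W →L[ℝ] X →L[ℝ] ℝ := fun q =>
    (G q).bilinearComp (ContinuousLinearMap.inr ℝ X W) (ContinuousLinearMap.inl ℝ X W)
  have hg₁ : ContDiffOn ℝ ∞ g₁ Ψ.source :=
    contDiffOn_clm_apply.2 fun u => contDiffOn_clm_apply.2 fun u' =>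
      (hG.clm_apply contDiffOn_const).clm_apply contDiffOn_const
  have hg₂ : ContDiffOn ℝ ∞ g₂ Ψ.source :=
    contDiffOn_clm_apply.2 fun u => contDiffOn_clm_apply.2 fun u' =>
      (hG.clm_apply contDiffOn_const).clm_apply contDiffOn_const
  have hinv : ∀ q ∈ Ψ.source, (g₁ q).IsInvertible := fun q hq =>
    isInvertible_of_posDef _ fun u hu => coordMetric_pos hΨ hq (by simpa using hu)
  refine ⟨fun q => -((g₁ q).inverse.comp (g₂ q)), ?_, fun q hq w => ?_⟩
  · have h1 : ContDiffOn ℝ ∞ (fun q => (g₁ q).inverse) Ψ.source := fun q hq =>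
      (hinv q hq).contDiffAt_map_inverse.comp_contDiffWithinAt q (hg₁ q hq)
    exact (h1.clm_comp hg₂).neg
  · rw [hD' (Ψ q), Submodule.mem_orthogonal']
    intro z hz
    obtain ⟨_, ⟨u, rfl⟩, rfl⟩ := (hD q hq z).1 hz
    set a : X := (g₁ q).inverse (g₂ q w) with ha
    have h1 : g₁ q a = g₂ q w := by
      obtain ⟨e, he⟩ := hinv q hq
      rw [ha, ← he, ContinuousLinearMap.inverse_equiv]
      simp
    have h2 : G q (-a, w) (u, 0) = -g₁ q a u + g₂ q w u := by
      have h3 : ((-a, w) : X × W) = -(a, 0) + (0, w) := by simp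
      rw [h3, map_add, map_neg]
      rfl
    rw [h1, neg_add_cancel] at h2
    exact h2

/-- The Frobenius integrability condition for the graphs that span a totally geodesic
distribution. -/
theorem IsTotallyGeodesic.fderiv_graph_symm (htg : IsTotallyGeodesic D' D)
    (hΨ : IsSmoothParam E Ψ)
    (hD : IsCoordDistribution Ψ D (LinearMap.range (LinearMap.inl ℝ X W)))
    {A : X × W → W →L[ℝ] X} (hA : ContDiffOn ℝ ∞ A Ψ.source)
    (hAD' : ∀ q ∈ Ψ.source, ∀ w, mfderiv 𝓘(ℝ, X × W) 𝓘(ℝ, E) Ψ q (A q w, w) ∈ D' (Ψ q))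
    {q : X × W} (hq : q ∈ Ψ.source) (v w : W) :
    fderiv ℝ A q (A q w, w) v = fderiv ℝ A q (A q v, v) w := by
  let Z : W → X × W → X × W := fun w q => (A q w, w)
  have hAq : ContDiffAt ℝ ∞ A q := hA.contDiffAt (Ψ.open_source.mem_nhds hq)
  have hZ : ∀ w, ContDiffAt ℝ ∞ (Z w) q := fun w =>
    (hAq.clm_apply contDiffAt_const).prodMk contDiffAt_const
  have hZd : ∀ w x, fderiv ℝ (Z w) q x = (fderiv ℝ A q x w, 0) := fun w x => by
    have h1 : HasFDerivAt (Z w) _ q :=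
      (((hAq.differentiableAt (by simp)).hasFDerivAt).clm_apply (hasFDerivAt_const w q)).prodMk
        (hasFDerivAt_const w q)
    rw [h1.fderiv]
    simp
  have hZD' : ∀ w, ∀ᶠ x in 𝓝 (Ψ q), coordField E Ψ (Z w) x ∈ D' x := fun w => by
    filter_upwards [Ψ.open_target.mem_nhds (Ψ.map_source hq)] with x hx
    rw [← Ψ.right_inv hx, hΨ.coordField_apply _ (Ψ.map_target hx)]
    exact hAD' _ (Ψ.map_target hx) w
  set a : X := fderiv ℝ A q (A q w, w) v - fderiv ℝ A q (A q v, v) w with ha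
  have hbr : VectorField.lieBracket ℝ (Z w) (Z v) q = (a, 0) := by
    rw [VectorField.lieBracket_eq]
    simp only [hZd, Prod.mk_sub_mk, sub_zero, Z, ha]
  -- the bracket is both tangent to `D` and orthogonal to it
  have h := htg.inner_mlieBracket (hΨ.mdiffAt_coordField hq (hZ w))
    (hΨ.mdiffAt_coordField hq (hZ v))
    (hΨ.mdiffAt_coordField hq (contDiffAt_const (c := ((a, 0) : X × W)))) (hZD' w) (hZD' v)
    (hD.eventually_coordField_mem hΨ hq ⟨a, rfl⟩)
  rw [hΨ.mlieBracket_coordField hq (hZ w) (hZ v), hbr, hΨ.coordField_apply _ hq,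
    ← coordMetric_apply] at h
  by_contra hne
  exact (coordMetric_pos hΨ hq (u := (a, 0)) (by simpa [ha, sub_eq_zero] using hne)).ne' h

/-- The parameter space `ℝᵏ × ℝˡ` of a local product. -/
abbrev EucProd (k l : ℕ) : Type := EuclideanSpace ℝ (Fin k) × EuclideanSpace ℝ (Fin l)

/-- If the horizontal distribution of a submersion is totally geodesic, hence involutive, then there
are coordinates in which both the vertical and the horizontal distribution are constant. -/
theorem exists_param_of_isTotallyGeodesic_horizontal
    {E' : Type*} [NormedAddCommGroup E'] [NormedSpace ℝ E'] [FiniteDimensional ℝ E']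
    {N : Type*} [TopologicalSpace N] [ChartedSpace E' N] [IsManifold 𝓘(ℝ, E') ∞ N]
    {F : M → N} (hF : ContMDiff 𝓘(ℝ, E) 𝓘(ℝ, E') ∞ F)
    (hsurj : ∀ x, Function.Surjective (mfderiv 𝓘(ℝ, E) 𝓘(ℝ, E') F x))
    (hH : IsTotallyGeodesic (horizontal E E' F) (vertical E E' F)) (p : M) :
    ∃ (k l : ℕ) (Ψ : OpenPartialHomeomorph (EucProd k l) M),
      IsSmoothParam E Ψ ∧ 0 ∈ Ψ.source ∧ Ψ 0 = p ∧
      IsCoordDistribution Ψ (vertical E E' F) (LinearMap.range (LinearMap.inl ℝ _ _)) ∧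
      IsCoordDistribution Ψ (horizontal E E' F) (LinearMap.range (LinearMap.inr ℝ _ _)) := by
  have horth : ∀ x, vertical E E' F x ⟂ horizontal E E' F x := fun x =>
    Submodule.isOrtho_orthogonal_right _
  obtain ⟨k, l, Ψ₀, hΨ₀, h0Ψ₀, hΨ₀0, hver₀⟩ := exists_param_of_submersion hF p (hsurj p)
  obtain ⟨A, hA, hAH⟩ := exists_graph_orthogonal (D' := horizontal E E' F) hΨ₀ hver₀ fun _ => rfl
  obtain ⟨Θ, h0Θ, hΘ0, hΘt, hΘs, hΘs', hΘ2, hΘd⟩ := exists_foliated_coordinates A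
    Ψ₀.open_source h0Ψ₀ hA fun q hq v w => hH.fderiv_graph_symm hΨ₀ hver₀ hA hAH hq v w
  let Ψ := Θ.trans Ψ₀
  have hΨ : IsSmoothParam E Ψ := hΨ₀.trans hΘs hΘs'
  have hΨsrc : Ψ.source = Θ.source := by
    ext q
    exact ⟨fun hq => hq.1, fun hq => ⟨hq, hΘt (Θ.map_source hq)⟩⟩
  have hΘdiff : ∀ q ∈ Θ.source, DifferentiableAt ℝ Θ q := fun q hq =>
    (hΘs.contDiffAt (Θ.open_source.mem_nhds hq)).differentiableAt (by simp)
  have hΨd : ∀ q ∈ Θ.source, ∀ u, mfderiv 𝓘(ℝ, EucProd k l) 𝓘(ℝ, E) Ψ q u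
      = mfderiv 𝓘(ℝ, EucProd k l) 𝓘(ℝ, E) Ψ₀ (Θ q) (fderiv ℝ Θ q u) := by
    intro q hq u
    have h1 := (hΨ₀.mdifferentiable.mdifferentiableAt (hΘt (Θ.map_source hq))).hasMFDerivAt.comp q
      (hΘdiff q hq).hasFDerivAt.hasMFDerivAt
    exact congrArg (fun L => L u) (HasMFDerivAt.mfderiv (f := Ψ) h1)
  have hΘd2 : ∀ q ∈ Θ.source, ∀ u v, (fderiv ℝ Θ q (u, v)).2 = v := by
    intro q hq u v
    have h1 : (fun q => (Θ q).2) =ᶠ[𝓝 q] Prod.snd := by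
      filter_upwards [Θ.open_source.mem_nhds hq] with q hq using hΘ2 q hq
    have h2 := ((hΘdiff q hq).hasFDerivAt.snd.congr_of_eventuallyEq h1.symm).unique hasFDerivAt_snd
    exact congrArg (fun L => L (u, v)) h2
  have hver : ∀ q ∈ Θ.source, ∀ u v,
      mfderiv 𝓘(ℝ, EucProd k l) 𝓘(ℝ, E) Ψ q (u, v) ∈ vertical E E' F (Ψ q) ↔ v = 0 := by
    intro q hq u v
    have h2 := hΘd2 q hq u v
    refine (Iff.of_eq (congrArg (· ∈ vertical E E' F (Ψ q)) (hΨd q hq (u, v)))).trans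
      ((hver₀ (Θ q) (hΘt (Θ.map_source hq)) _).trans ⟨?_, fun h => ?_⟩)
    · rintro ⟨_, ⟨u', rfl⟩, h⟩
      exact h2.symm.trans
        (congrArg Prod.snd ((hΨ₀.mfderiv_bijective (hΘt (Θ.map_source hq))).1 h))
    · have h3 : LinearMap.inl ℝ _ _ (fderiv ℝ Θ q (u, v)).1 = fderiv ℝ Θ q (u, v) :=
        Prod.ext rfl (h2.trans h).symm
      exact ⟨_, ⟨_, h3⟩, rfl⟩
  have hhor' : ∀ q ∈ Θ.source, ∀ v,
      mfderiv 𝓘(ℝ, EucProd k l) 𝓘(ℝ, E) Ψ q (0, v) ∈ horizontal E E' F (Ψ q) := by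
    intro q hq v
    exact (congrArg (· ∈ horizontal E E' F (Ψ q)) ((hΨd q hq (0, v)).trans
      (congrArg (mfderiv 𝓘(ℝ, EucProd k l) 𝓘(ℝ, E) Ψ₀ (Θ q)) (hΘd q hq v)))).mpr
      (hAH _ (hΘt (Θ.map_source hq)) v)
  have hD₁ : IsCoordDistribution Ψ (vertical E E' F) (LinearMap.range (LinearMap.inl ℝ _ _)) := by
    intro q hq w
    obtain ⟨⟨u, v⟩, rfl⟩ := (hΨ.mfderiv_bijective hq).2 w
    rw [hΨsrc] at hq
    refine (hver q hq u v).trans ⟨?_, ?_⟩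
    · rintro rfl
      exact ⟨_, ⟨u, rfl⟩, rfl⟩
    · rintro ⟨_, ⟨u', rfl⟩, h⟩
      exact congrArg Prod.snd ((hΨ.mfderiv_bijective (hΨsrc ▸ hq)).1 h)
  have hD₂ : IsCoordDistribution Ψ (horizontal E E' F)
      (LinearMap.range (LinearMap.inr ℝ _ _)) := by
    intro q hq w
    obtain ⟨⟨u, v⟩, rfl⟩ := (hΨ.mfderiv_bijective hq).2 w
    have hqΘ := hΨsrc ▸ hq
    constructor
    · intro h
      have h1 : mfderiv 𝓘(ℝ, EucProd k l) 𝓘(ℝ, E) Ψ q (u, 0) ∈ vertical E E' F (Ψ q) :=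
        (hver q hqΘ u 0).2 rfl
      have h2 : mfderiv 𝓘(ℝ, EucProd k l) 𝓘(ℝ, E) Ψ q (u, 0) ∈ horizontal E E' F (Ψ q) := by
        have h3 : ((u, 0) : EucProd k l)
            = (u, v) - (0, v) := by simp
        have h4 := Submodule.sub_mem _ h (hhor' q hqΘ v)
        rw [h3]
        exact (map_sub (mfderiv 𝓘(ℝ, EucProd k l) 𝓘(ℝ, E) Ψ q) _ _) ▸ h4
      have h3 : mfderiv 𝓘(ℝ, EucProd k l) 𝓘(ℝ, E) Ψ q (u, 0) = 0 :=
        inner_self_eq_zero.1 ((horth (Ψ q)).inner_eq h1 h2)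
      have h4 := (hΨ.mfderiv_bijective hq).1 (h3.trans (map_zero _).symm)
      have h5 : u = 0 := congrArg Prod.fst h4
      exact ⟨_, ⟨v, rfl⟩, by rw [h5]; rfl⟩
    · rintro ⟨_, ⟨v', rfl⟩, h⟩
      rw [h]
      exact hhor' q hqΘ v'
  refine ⟨k, l, Ψ, hΨ, hΨsrc ▸ h0Θ, ?_, hD₁, hD₂⟩
  change Ψ₀ (Θ 0) = p
  rw [hΘ0, hΨ₀0]

/-- If the leaves of `D` are the first coordinate slices and `D` is totally geodesic, then the metric
coefficients in the directions of `D` do not depend on the second coordinate. -/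
theorem IsTotallyGeodesic.coordMetric_inl_eq (htg : IsTotallyGeodesic D D')
    (hΨ : IsSmoothParam E Ψ)
    (hD : IsCoordDistribution Ψ D (LinearMap.range (LinearMap.inl ℝ X W)))
    (hD' : IsCoordDistribution Ψ D' (LinearMap.range (LinearMap.inr ℝ X W)))
    (horth : ∀ x, D x ⟂ D' x) {a : X} {U : Set W} (hUo : IsOpen U) (hUc : IsPreconnected U)
    (hU : ∀ b ∈ U, (a, b) ∈ Ψ.source) {b b' : W} (hb : b ∈ U) (hb' : b' ∈ U) (u u' : X) :
    coordMetric E Ψ (a, b) (u, 0) (u', 0) = coordMetric E Ψ (a, b') (u, 0) (u', 0) := by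
  have hd : ∀ b ∈ U, HasFDerivAt (fun b => coordMetric E Ψ (a, b) (u, 0) (u', 0))
      ((fderiv ℝ (fun q => coordMetric E Ψ q (u, 0) (u', 0)) (a, b)).comp
        (ContinuousLinearMap.inr ℝ X W)) b := fun b hb =>
    HasFDerivAt.comp b (g := fun q => coordMetric E Ψ q (u, 0) (u', 0))
      ((((hΨ.contDiffOn_coordMetric.contDiffAt (Ψ.open_source.mem_nhds (hU b hb))).clm_apply
        contDiffAt_const).clm_apply contDiffAt_const).differentiableAt (by simp)).hasFDerivAt
      (hasFDerivAt_prodMk_right a b)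
  refine hUo.is_const_of_fderiv_eq_zero hUc
    (fun b hb => (hd b hb).differentiableAt.differentiableWithinAt) (fun b hb => ?_) hb hb'
  rw [(hd b hb).fderiv]
  ext v
  exact htg.fderiv_coordMetric hΨ hD hD' horth (hU b hb) ⟨u, rfl⟩ ⟨u', rfl⟩ ⟨v, rfl⟩

/-- The analogue of `IsTotallyGeodesic.coordMetric_inl_eq` for the second factor. -/
theorem IsTotallyGeodesic.coordMetric_inr_eq (htg : IsTotallyGeodesic D' D)
    (hΨ : IsSmoothParam E Ψ)
    (hD : IsCoordDistribution Ψ D (LinearMap.range (LinearMap.inl ℝ X W)))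
    (hD' : IsCoordDistribution Ψ D' (LinearMap.range (LinearMap.inr ℝ X W)))
    (horth : ∀ x, D x ⟂ D' x) {b : W} {U : Set X} (hUo : IsOpen U) (hUc : IsPreconnected U)
    (hU : ∀ a ∈ U, (a, b) ∈ Ψ.source) {a a' : X} (ha : a ∈ U) (ha' : a' ∈ U) (v v' : W) :
    coordMetric E Ψ (a, b) (0, v) (0, v') = coordMetric E Ψ (a', b) (0, v) (0, v') := by
  have hd : ∀ a ∈ U, HasFDerivAt (fun a => coordMetric E Ψ (a, b) (0, v) (0, v'))
      ((fderiv ℝ (fun q => coordMetric E Ψ q (0, v) (0, v')) (a, b)).comp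
        (ContinuousLinearMap.inl ℝ X W)) a := fun a ha =>
    HasFDerivAt.comp a (g := fun q => coordMetric E Ψ q (0, v) (0, v'))
      ((((hΨ.contDiffOn_coordMetric.contDiffAt (Ψ.open_source.mem_nhds (hU a ha))).clm_apply
        contDiffAt_const).clm_apply contDiffAt_const).differentiableAt (by simp)).hasFDerivAt
      (hasFDerivAt_prodMk_left a b)
  refine hUo.is_const_of_fderiv_eq_zero hUc
    (fun a ha => (hd a ha).differentiableAt.differentiableWithinAt) (fun a ha => ?_) ha ha'
  rw [(hd a ha).fderiv]
  ext u
  exact htg.fderiv_coordMetric hΨ hD' hD (fun x => (horth x).symm) (hU a ha)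
    ⟨v, rfl⟩ ⟨v', rfl⟩ ⟨u, rfl⟩

theorem contDiffOn_coordMetric_slice {Y E₀ : Type*} [NormedAddCommGroup Y] [NormedSpace ℝ Y]
    [FiniteDimensional ℝ Y] [NormedAddCommGroup E₀] [NormedSpace ℝ E₀] [FiniteDimensional ℝ E₀]
    {Ψ : OpenPartialHomeomorph E₀ M} (hΨ : IsSmoothParam E Ψ) {s : Y → E₀} (hs : ContDiff ℝ ∞ s)
    (i : Y →L[ℝ] E₀) {U : Set Y} (hU : ∀ a ∈ U, s a ∈ Ψ.source) :
    ContDiffOn ℝ ∞ (fun a => (coordMetric E Ψ (s a)).bilinearComp i i) U := by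
  have h : ContDiffOn ℝ ∞ (fun a => coordMetric E Ψ (s a)) U :=
    hΨ.contDiffOn_coordMetric.comp hs.contDiffOn hU
  rw [contDiffOn_clm_apply]
  intro u
  rw [contDiffOn_clm_apply]
  intro u'
  exact (h.clm_apply contDiffOn_const).clm_apply contDiffOn_const

/-- The metric of `M` induces a Riemannian metric on a coordinate slice `a ↦ Ψ (s a)`. -/
theorem isRiemannianMetricOn_slice {k : ℕ} {E₀ : Type*} [NormedAddCommGroup E₀]
    [NormedSpace ℝ E₀] [FiniteDimensional ℝ E₀] {Ψ : OpenPartialHomeomorph E₀ M}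
    (hΨ : IsSmoothParam E Ψ) {s : EuclideanSpace ℝ (Fin k) → E₀} (hs : ContDiff ℝ ∞ s)
    {i : EuclideanSpace ℝ (Fin k) →L[ℝ] E₀} (hi : Function.Injective i)
    {U : Set (EuclideanSpace ℝ (Fin k))} (hU : ∀ a ∈ U, s a ∈ Ψ.source) :
    IsRiemannianMetricOn U fun a => (coordMetric E Ψ (s a)).bilinearComp i i where
  smooth := contDiffOn_coordMetric_slice hΨ hs i hU
  symm a _ u v := by
    rw [ContinuousLinearMap.bilinearComp_apply, ContinuousLinearMap.bilinearComp_apply]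
    exact coordMetric_comm _ _ _ _
  pos a ha u hu := by
    rw [ContinuousLinearMap.bilinearComp_apply]
    exact coordMetric_pos hΨ (hU a ha) ((map_ne_zero_iff i hi).2 hu)

/-- Two orthogonal totally geodesic distributions that are constant in suitable coordinates are
tangent to the factors of a local Riemannian product: the metric splits, because its coefficients
along either foliation do not depend on the transverse coordinates. -/
theorem isLocallyRiemannianProduct_of_isTotallyGeodesic (horth : ∀ x, D x ⟂ D' x)
    (hV : IsTotallyGeodesic D D') (hH : IsTotallyGeodesic D' D)
    (hparam : ∀ p, ∃ (k l : ℕ) (Ψ : OpenPartialHomeomorph (EucProd k l) M),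
      IsSmoothParam E Ψ ∧ 0 ∈ Ψ.source ∧ Ψ 0 = p ∧
      IsCoordDistribution Ψ D (LinearMap.range (LinearMap.inl ℝ _ _)) ∧
      IsCoordDistribution Ψ D' (LinearMap.range (LinearMap.inr ℝ _ _))) :
    IsLocallyRiemannianProduct D D' := by
  intro p
  obtain ⟨k, l, Ψ, hΨ, h0Ψ, hΨ0, hD₁, hD₂⟩ := hparam p
  obtain ⟨r, hr, hball⟩ := Metric.isOpen_iff.1 Ψ.open_source 0 h0Ψ
  let U₁ : Set (EuclideanSpace ℝ (Fin k)) := Metric.ball 0 r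
  let U₂ : Set (EuclideanSpace ℝ (Fin l)) := Metric.ball 0 r
  have hU₁0 : 0 ∈ U₁ := Metric.mem_ball_self hr
  have hU₂0 : 0 ∈ U₂ := Metric.mem_ball_self hr
  have hU : U₁ ×ˢ U₂ ⊆ Ψ.source := by
    rw [ball_prod_same]; exact hball
  have hU₁o : IsOpen U₁ := Metric.isOpen_ball
  have hU₂o : IsOpen U₂ := Metric.isOpen_ball
  have hU₁c : IsConnected U₁ := ⟨⟨0, hU₁0⟩, (convex_ball 0 r).isPreconnected⟩
  have hU₂c : IsConnected U₂ := ⟨⟨0, hU₂0⟩, (convex_ball 0 r).isPreconnected⟩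
  let G := coordMetric E Ψ
  let i₁ := ContinuousLinearMap.inl ℝ (EuclideanSpace ℝ (Fin k)) (EuclideanSpace ℝ (Fin l))
  let i₂ := ContinuousLinearMap.inr ℝ (EuclideanSpace ℝ (Fin k)) (EuclideanSpace ℝ (Fin l))
  let g₁ := fun a => (G (a, 0)).bilinearComp i₁ i₁
  let g₂ := fun b => (G (0, b)).bilinearComp i₂ i₂
  have hg₁ : IsRiemannianMetricOn U₁ g₁ :=
    isRiemannianMetricOn_slice hΨ (s := fun a => (a, 0)) (contDiff_id.prodMk contDiff_const)
      (i := i₁) LinearMap.inl_injective fun a ha => hU ⟨ha, hU₂0⟩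
  have hg₂ : IsRiemannianMetricOn U₂ g₂ :=
    isRiemannianMetricOn_slice hΨ (s := fun b => (0, b)) (contDiff_const.prodMk contDiff_id)
      (i := i₂) LinearMap.inr_injective fun b hb => hU ⟨hU₁0, hb⟩
  have hG₁ : ∀ a ∈ U₁, ∀ b ∈ U₂, ∀ u u', G (a, b) (u, 0) (u', 0) = g₁ a u u' := by
    intro a ha b hb u u'
    rw [ContinuousLinearMap.bilinearComp_apply]
    exact hV.coordMetric_inl_eq hΨ hD₁ hD₂ horth hU₂o hU₂c.isPreconnected
      (fun b hb => hU ⟨ha, hb⟩) hb hU₂0 u u'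
  have hG₂ : ∀ a ∈ U₁, ∀ b ∈ U₂, ∀ v v', G (a, b) (0, v) (0, v') = g₂ b v v' := by
    intro a ha b hb v v'
    rw [ContinuousLinearMap.bilinearComp_apply]
    exact hH.coordMetric_inr_eq hΨ hD₁ hD₂ horth hU₁o hU₁c.isPreconnected
      (fun a ha => hU ⟨ha, hb⟩) ha hU₁0 v v'
  have hsrc : (Ψ.restrOpen (U₁ ×ˢ U₂) (hU₁o.prod hU₂o)).source = U₁ ×ˢ U₂ := by
    rw [Ψ.restrOpen_source, inter_eq_right.2 hU]
  refine ⟨k, l, U₁, U₂, g₁, g₂, Ψ.restrOpen (U₁ ×ˢ U₂) (hU₁o.prod hU₂o), hU₁o, hU₁c, hg₁, hU₂o,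
    hU₂c, hg₂, hsrc, ?_, ?_, ?_, ?_⟩
  · have h1 := (Ψ.restrOpen (U₁ ×ˢ U₂) (hU₁o.prod hU₂o)).map_source (x := 0)
      (by rw [hsrc]; exact ⟨hU₁0, hU₂0⟩)
    exact hΨ0 ▸ h1
  · exact hΨ.smooth.mono fun q hq => hq.1
  · exact hΨ.smooth_symm.mono fun x hx => hx.1
  · intro a ha b hb
    have hq : (a, b) ∈ Ψ.source := hU (mk_mem_prod ha hb)
    refine ⟨fun u u' v v' => ?_, fun w => ?_, fun w => ?_⟩
    · have h1 : ∀ u v, ((u, v) : EucProd k l)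
          = (u, 0) + (0, v) := by simp
      have h2 : G (a, b) (u, 0) (0, v') = 0 := (horth _).inner_eq
        ((hD₁ _ hq _).2 ⟨_, ⟨u, rfl⟩, rfl⟩) ((hD₂ _ hq _).2 ⟨_, ⟨v', rfl⟩, rfl⟩)
      have h3 : G (a, b) (0, v) (u', 0) = 0 := (horth _).symm.inner_eq
        ((hD₂ _ hq _).2 ⟨_, ⟨v, rfl⟩, rfl⟩) ((hD₁ _ hq _).2 ⟨_, ⟨u', rfl⟩, rfl⟩)
      change G (a, b) (u, v) (u', v') = _
      rw [h1 u v, h1 u' v', ← hG₁ a ha b hb, ← hG₂ a ha b hb]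
      simp only [map_add, add_apply, h2, h3]
      ring
    · exact (hD₁ _ hq w).trans
        (mem_range_inl fun z => w = mfderiv 𝓘(ℝ, EucProd k l) 𝓘(ℝ, E) Ψ (a, b) z)
    · exact (hD₂ _ hq w).trans
        (mem_range_inr fun z => w = mfderiv 𝓘(ℝ, EucProd k l) 𝓘(ℝ, E) Ψ (a, b) z)

end Splitting

/-! ### Global vertical and horizontal fields -/

section GlobalFields

variable {E : Type*} [NormedAddCommGroup E] [NormedSpace ℝ E] [FiniteDimensional ℝ E]
  {M : Type*} [TopologicalSpace M] [ChartedSpace E M] [IsManifold 𝓘(ℝ, E) ∞ M]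
  {E' : Type*} [NormedAddCommGroup E'] [NormedSpace ℝ E'] [FiniteDimensional ℝ E']
  {N : Type*} [TopologicalSpace N] [ChartedSpace E' N] [IsManifold 𝓘(ℝ, E') ∞ N]
  {F : M → N}

omit [FiniteDimensional ℝ E] in
theorem IsSmoothField.mdiffAt {X : Π x : M, TangentSpace 𝓘(ℝ, E) x} (hX : IsSmoothField X)
    (p : M) : MDiffAt (T% X) p :=
  (hX p).mdifferentiableAt (by simp)

/-- Every vertical vector of a submersion extends to a smooth vertical field on all of `M`: cut off
a coordinate field of adapted coordinates by a bump function. -/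
theorem exists_isSmoothField_vertical [T2Space M] (hF : ContMDiff 𝓘(ℝ, E) 𝓘(ℝ, E') ∞ F) {p : M}
    (hsurj : Function.Surjective (mfderiv 𝓘(ℝ, E) 𝓘(ℝ, E') F p)) {v : TangentSpace 𝓘(ℝ, E) p}
    (hv : v ∈ vertical E E' F p) :
    ∃ V : Π x : M, TangentSpace 𝓘(ℝ, E) x,
      IsSmoothField V ∧ (∀ x, V x ∈ vertical E E' F x) ∧ V p = v := by
  obtain ⟨k, l, Ψ, hΨ, h0, rfl, hD⟩ := exists_param_of_submersion hF p hsurj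
  obtain ⟨u, hu, rfl⟩ := (hD 0 h0 v).1 hv
  obtain ⟨ρ, -, hρ⟩ := (SmoothBumpFunction.nhds_basis_tsupport (I := 𝓘(ℝ, E)) (Ψ 0)).mem_iff.1
    (Ψ.open_target.mem_nhds (Ψ.map_source h0))
  refine ⟨(ρ : M → ℝ) • coordField E Ψ fun _ => u, ?_, fun x => ?_, ?_⟩
  · refine ContMDiffOn.smul_section_of_tsupport ρ.contMDiff.contMDiffOn Ψ.open_target hρ ?_
    intro x hx
    have h := hΨ.contMDiffAt_coordField (Ψ.map_target hx) (contDiffAt_const (c := u))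
    rw [Ψ.right_inv hx] at h
    exact h.contMDiffWithinAt
  · by_cases hx : x ∈ Ψ.target
    · refine Submodule.smul_mem _ _ ?_
      have h : coordField E Ψ (fun _ => u) (Ψ (Ψ.symm x)) ∈ vertical E E' F (Ψ (Ψ.symm x)) :=
        (hD _ (Ψ.map_target hx) _).2 ⟨u, hu, hΨ.coordField_apply _ (Ψ.map_target hx)⟩
      rwa [Ψ.right_inv hx] at h
    · have h : ρ x = 0 := image_eq_zero_of_notMem_tsupport fun h => hx (hρ h)
      rw [Pi.smul_apply', h, zero_smul]
      exact Submodule.zero_mem _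
  · rw [Pi.smul_apply', ρ.eq_one, one_smul, hΨ.coordField_apply _ h0]

omit [FiniteDimensional ℝ E] in
theorem IsSmoothField.applyField_φ (S : AlmostContactStructure E M)
    {X : Π x : M, TangentSpace 𝓘(ℝ, E) x} (hX : IsSmoothField X) :
    IsSmoothField (applyField S.φ X) :=
  ContMDiff.clm_bundle_apply (b := fun x : M => x) S.smooth_φ hX

end GlobalFields

/-! ### Cosymplectic identities -/

section Cosymplectic

variable {E : Type*} [NormedAddCommGroup E] [NormedSpace ℝ E]
  {M : Type*} [TopologicalSpace M] [ChartedSpace E M] [IsManifold 𝓘(ℝ, E) ∞ M]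
  [RiemannianBundle (fun x : M => TangentSpace 𝓘(ℝ, E) x)]
  {S : AlmostContactStructure E M}

namespace AlmostContactStructure

/-- `φ` is skew-adjoint. -/
theorem IsMetricCompatible.inner_φ_right (hS : S.IsMetricCompatible) {x : M}
    (v w : TangentSpace 𝓘(ℝ, E) x) : inner ℝ v (S.φ x w) = -inner ℝ (S.φ x v) w := by
  have h := hS.inner_φ_φ x v (S.φ x w)
  rw [S.φ_φ, S.η_φ, mul_zero, sub_zero, inner_add_right, inner_neg_right, inner_smul_right,
    ← hS.η_eq, S.η_φ, mul_zero, add_zero] at h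
  exact h.symm

/-- `φ` is injective modulo `ξ`. -/
theorem IsMetricCompatible.inner_eq_of_φ_eq (hS : S.IsMetricCompatible) {x : M}
    {v w z : TangentSpace 𝓘(ℝ, E) x} (h : S.φ x v = S.φ x w) (hz : S.η x z = 0) :
    (inner ℝ v z : ℝ) = inner ℝ w z := by
  have h1 := congrArg (S.φ x) h
  rw [S.φ_φ, S.φ_φ] at h1
  have h2 := congrArg (fun y => (inner ℝ y z : ℝ)) h1
  rw [hS.η_eq, real_inner_comm] at hz
  simp only [inner_add_left, inner_neg_left, inner_smul_left, hz, mul_zero, add_zero,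
    neg_inj] at h2
  exact h2

variable [FiniteDimensional ℝ E]
  [IsContMDiffRiemannianBundle 𝓘(ℝ, E) ∞ E (fun x : M => TangentSpace 𝓘(ℝ, E) x)]

/-- The part of `∇ξ = 0` that is needed below. Closedness of the fundamental form and normality
give `ξ g(X, φY) = g([ξ, X], φY) + g([ξ, φY], X)`, so `ξ` is a Killing field, and closedness of `η`
kills the antisymmetric part of `∇ξ`. -/
theorem IsCosymplectic.inner_leviCivita_ξ (hS : S.IsCosymplectic)
    {X Y : Π x : M, TangentSpace 𝓘(ℝ, E) x} (hX : IsSmoothField X) (hY : IsSmoothField Y)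
    (hηX : ∀ x, S.η x (X x) = 0) (p : M) :
    inner ℝ (leviCivita E M S.ξ p (X p)) (S.φ p (Y p)) = 0 := by
  have hZ := hY.applyField_φ S
  have hconst : ∀ f : M → ℝ, (∀ x, f x = 0) → mvfderiv 𝓘(ℝ, E) f p = 0 := by
    intro f hf
    have : f = fun _ => 0 := funext hf
    ext w
    rw [mvfderiv, this, mfderiv_const]
    rfl
  have hφξ : applyField S.φ S.ξ = 0 := funext fun x => S.φ_ξ x
  have hηX' : ∀ x, (inner ℝ (X x) (S.ξ x) : ℝ) = 0 := fun x => by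
    rw [← hS.metric.η_eq, hηX]
  have hηZ' : ∀ x, (inner ℝ (applyField S.φ Y x) (S.ξ x) : ℝ) = 0 := fun x => by
    rw [← hS.metric.η_eq]
    exact S.η_φ x _
  -- normality applied to `ξ` and `Y`
  have h1 := hS.normal S.ξ Y S.smooth_ξ hY p
  rw [hS.closed_η _ _ S.smooth_ξ hY, zero_smul, add_zero, nijenhuis, hφξ,
    VectorField.mlieBracket_zero_left, VectorField.mlieBracket_zero_left, Pi.zero_apply, map_zero,
    add_zero, sub_zero, sub_eq_zero] at h1
  have h2 := hS.metric.inner_eq_of_φ_eq h1 (hηX p)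
  -- closedness of `Φ`, applied to `X`, `Y` and `ξ`
  have h3 := hS.closed_Φ X Y S.ξ hX hY S.smooth_ξ p
  rw [extDerivTwoForm, hconst (S.fundamentalForm Y S.ξ) fun x => by
      rw [fundamentalForm, S.φ_ξ, inner_zero_right],
    hconst (S.fundamentalForm S.ξ X) fun x => by
      rw [fundamentalForm, real_inner_comm, ← hS.metric.η_eq, S.η_φ]] at h3
  simp only [fundamentalForm, S.φ_ξ, inner_zero_right] at h3
  rw [hS.metric.inner_φ_right (VectorField.mlieBracket 𝓘(ℝ, E) Y S.ξ p),
    VectorField.mlieBracket_swap_apply (V := Y), map_neg, inner_neg_left, h2] at h3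
  -- closedness of `η`, applied to `X` and `φ Y`
  have h4 := hS.closed_η X _ hX hZ p
  rw [extDerivOneForm, hconst (fun y => S.η y (applyField S.φ Y y)) fun x => S.η_φ x _,
    hconst _ hηX, hS.metric.η_eq] at h4
  have h5 := inner_leviCivita (hX.mdiffAt p) (S.smooth_ξ.mdiffAt p) (hZ.mdiffAt p)
  refine h5.trans ?_
  rw [koszul, hconst (fun y => inner ℝ (S.ξ y) (applyField S.φ Y y)) fun x => by
      rw [real_inner_comm, hηZ'], hconst _ hηX',
    VectorField.mlieBracket_swap_apply (V := X) (W := S.ξ), inner_neg_left]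
  have h6 : mvfderiv 𝓘(ℝ, E) (fun y => inner ℝ (X y) (applyField S.φ Y y)) p (S.ξ p)
      = mvfderiv 𝓘(ℝ, E) (S.fundamentalForm X Y) p (S.ξ p) := rfl
  rw [h6]
  simp only [zero_apply] at h3 h4 ⊢
  simp only [applyField] at h4 ⊢ h3
  linarith

end AlmostContactStructure

end Cosymplectic

/-! ### O'Neill's tensors and totally geodesic distributions -/

section ONeill

variable {E : Type*} [NormedAddCommGroup E] [NormedSpace ℝ E] [FiniteDimensional ℝ E]
  {M : Type*} [TopologicalSpace M] [ChartedSpace E M] [IsManifold 𝓘(ℝ, E) ∞ M]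
  [RiemannianBundle (fun x : M => TangentSpace 𝓘(ℝ, E) x)]
  {E' : Type*} [NormedAddCommGroup E'] [NormedSpace ℝ E']
  {N : Type*} [TopologicalSpace N] [ChartedSpace E' N] {F : M → N}

omit [FiniteDimensional ℝ E] [IsManifold 𝓘(ℝ, E) ∞ M] in
theorem inner_eq_zero_of_mem_horizontal {x : M} {v w : TangentSpace 𝓘(ℝ, E) x}
    (hv : v ∈ vertical E E' F x) (hw : w ∈ horizontal E E' F x) : (inner ℝ v w : ℝ) = 0 :=
  (Submodule.mem_orthogonal _ _).1 hw v hv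

omit [IsManifold 𝓘(ℝ, E) ∞ M] in
theorem mem_vertical_iff {x : M} {v : TangentSpace 𝓘(ℝ, E) x} :
    v ∈ vertical E E' F x ↔ ∀ w ∈ horizontal E E' F x, (inner ℝ w v : ℝ) = 0 := by
  have : FiniteDimensional ℝ (TangentSpace 𝓘(ℝ, E) x) := inferInstanceAs (FiniteDimensional ℝ E)
  conv_lhs => rw [← (vertical E E' F x).orthogonal_orthogonal]
  exact Submodule.mem_orthogonal _ _

omit [IsManifold 𝓘(ℝ, E) ∞ M] in
theorem verProj_eq_zero_iff {Z : Π x : M, TangentSpace 𝓘(ℝ, E) x} {x : M} :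
    verProj E E' F Z x = 0 ↔ Z x ∈ horizontal E E' F x := by
  have : FiniteDimensional ℝ (TangentSpace 𝓘(ℝ, E) x) := inferInstanceAs (FiniteDimensional ℝ E)
  exact Submodule.starProjection_apply_eq_zero_iff _

omit [IsManifold 𝓘(ℝ, E) ∞ M] in
theorem horProj_eq_zero_iff {Z : Π x : M, TangentSpace 𝓘(ℝ, E) x} {x : M} :
    horProj E E' F Z x = 0 ↔ Z x ∈ vertical E E' F x := by
  have : FiniteDimensional ℝ (TangentSpace 𝓘(ℝ, E) x) := inferInstanceAs (FiniteDimensional ℝ E)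
  rw [horProj, Submodule.starProjection_apply_eq_zero_iff, horizontal,
    Submodule.orthogonal_orthogonal]

omit [IsManifold 𝓘(ℝ, E) ∞ M] in
theorem verProj_eq_self {Z : Π x : M, TangentSpace 𝓘(ℝ, E) x}
    (hZ : ∀ x, Z x ∈ vertical E E' F x) : verProj E E' F Z = Z := by
  funext x
  have : FiniteDimensional ℝ (TangentSpace 𝓘(ℝ, E) x) := inferInstanceAs (FiniteDimensional ℝ E)
  exact Submodule.starProjection_eq_self_iff.2 (hZ x)

omit [IsManifold 𝓘(ℝ, E) ∞ M] in
theorem horProj_eq_self {Z : Π x : M, TangentSpace 𝓘(ℝ, E) x}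
    (hZ : ∀ x, Z x ∈ horizontal E E' F x) : horProj E E' F Z = Z := by
  funext x
  have : FiniteDimensional ℝ (TangentSpace 𝓘(ℝ, E) x) := inferInstanceAs (FiniteDimensional ℝ E)
  exact Submodule.starProjection_eq_self_iff.2 (hZ x)

variable [IsContMDiffRiemannianBundle 𝓘(ℝ, E) ∞ E (fun x : M => TangentSpace 𝓘(ℝ, E) x)]

theorem nabla_zero_right (X : Π x : M, TangentSpace 𝓘(ℝ, E) x) : nabla X 0 = 0 := by
  funext x
  rw [nabla, CovariantDerivative.zero]
  rfl

theorem tensorA_eq_zero_iff {X Z : Π x : M, TangentSpace 𝓘(ℝ, E) x}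
    (hX : ∀ x, X x ∈ horizontal E E' F x) (hZ : ∀ x, Z x ∈ vertical E E' F x) :
    tensorA E E' F X Z = 0 ↔
      ∀ x, ∀ w ∈ horizontal E E' F x, (inner ℝ w (leviCivita E M Z x (X x)) : ℝ) = 0 := by
  have h1 : horProj E E' F Z = 0 := funext fun x => horProj_eq_zero_iff.2 (hZ x)
  have h2 : verProj E E' F (0 : Π x : M, TangentSpace 𝓘(ℝ, E) x) = 0 :=
    funext fun x => verProj_eq_zero_iff.2 (Submodule.zero_mem _)
  rw [tensorA, h1, horProj_eq_self hX, verProj_eq_self hZ, nabla_zero_right, h2, zero_add,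
    funext_iff]
  exact forall_congr' fun x => horProj_eq_zero_iff.trans mem_vertical_iff

theorem tensorT_eq_zero_iff {V Z : Π x : M, TangentSpace 𝓘(ℝ, E) x}
    (hV : ∀ x, V x ∈ vertical E E' F x) (hZ : ∀ x, Z x ∈ horizontal E E' F x) :
    tensorT E E' F V Z = 0 ↔
      ∀ x, ∀ w ∈ vertical E E' F x, (inner ℝ w (leviCivita E M Z x (V x)) : ℝ) = 0 := by
  have h1 : verProj E E' F Z = 0 := funext fun x => verProj_eq_zero_iff.2 (hZ x)
  have h2 : horProj E E' F (0 : Π x : M, TangentSpace 𝓘(ℝ, E) x) = 0 :=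
    funext fun x => horProj_eq_zero_iff.2 (Submodule.zero_mem _)
  rw [tensorT, h1, verProj_eq_self hV, horProj_eq_self hZ, nabla_zero_right, h2, zero_add,
    funext_iff]
  exact forall_congr' fun x => verProj_eq_zero_iff.trans (Submodule.mem_orthogonal _ _)

end ONeill

/-! ### Lagrangian submersions: `φ` exchanges vertical and horizontal vectors -/

section Lagrangian

variable {E : Type*} [NormedAddCommGroup E] [NormedSpace ℝ E] [FiniteDimensional ℝ E]
  {M : Type*} [TopologicalSpace M] [ChartedSpace E M] [IsManifold 𝓘(ℝ, E) ∞ M]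
  [RiemannianBundle (fun x : M => TangentSpace 𝓘(ℝ, E) x)]
  {E' : Type*} [NormedAddCommGroup E'] [NormedSpace ℝ E']
  {N : Type*} [TopologicalSpace N] [ChartedSpace E' N] {F : M → N}
  {S : AlmostContactStructure E M}

omit [FiniteDimensional ℝ E] in
theorem φ_mem_horizontal
    (hφ : ∀ x, (vertical E E' F x).map (S.φ x).toLinearMap = horizontal E E' F x) {x : M}
    {v : TangentSpace 𝓘(ℝ, E) x} (hv : v ∈ vertical E E' F x) :
    S.φ x v ∈ horizontal E E' F x :=
  hφ x ▸ Submodule.mem_map_of_mem hv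

omit [FiniteDimensional ℝ E] in
theorem η_eq_zero_of_mem_horizontal
    (hφ : ∀ x, (vertical E E' F x).map (S.φ x).toLinearMap = horizontal E E' F x) {x : M}
    {w : TangentSpace 𝓘(ℝ, E) x} (hw : w ∈ horizontal E E' F x) : S.η x w = 0 := by
  rw [← hφ x] at hw
  obtain ⟨v, -, rfl⟩ := hw
  exact S.η_φ x v

theorem ξ_mem_vertical (hS : S.IsMetricCompatible)
    (hφ : ∀ x, (vertical E E' F x).map (S.φ x).toLinearMap = horizontal E E' F x) (x : M) :
    S.ξ x ∈ vertical E E' F x :=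
  mem_vertical_iff.2 fun w hw => by
    rw [← hS.η_eq, η_eq_zero_of_mem_horizontal hφ hw]

theorem φ_mem_vertical (hS : S.IsMetricCompatible)
    (hφ : ∀ x, (vertical E E' F x).map (S.φ x).toLinearMap = horizontal E E' F x) {x : M}
    {w : TangentSpace 𝓘(ℝ, E) x} (hw : w ∈ horizontal E E' F x) :
    S.φ x w ∈ vertical E E' F x := by
  rw [← hφ x] at hw
  obtain ⟨v, hv, rfl⟩ := hw
  change S.φ x (S.φ x v) ∈ _
  rw [S.φ_φ]
  exact add_mem (neg_mem hv) (Submodule.smul_mem _ _ (ξ_mem_vertical hS hφ x))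

variable [FiniteDimensional ℝ E'] [IsManifold 𝓘(ℝ, E') ∞ N] [T2Space M]

/-- Every horizontal vector extends to a smooth horizontal field of the form `φ V`. -/
theorem exists_isSmoothField_horizontal (hF : ContMDiff 𝓘(ℝ, E) 𝓘(ℝ, E') ∞ F)
    (hsurj : ∀ x, Function.Surjective (mfderiv 𝓘(ℝ, E) 𝓘(ℝ, E') F x))
    (hφ : ∀ x, (vertical E E' F x).map (S.φ x).toLinearMap = horizontal E E' F x) {p : M}
    {w : TangentSpace 𝓘(ℝ, E) p} (hw : w ∈ horizontal E E' F p) :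
    ∃ V : Π x : M, TangentSpace 𝓘(ℝ, E) x, IsSmoothField V ∧ (∀ x, V x ∈ vertical E E' F x) ∧
      S.φ p (V p) = w := by
  rw [← hφ p] at hw
  obtain ⟨v, hv, rfl⟩ := hw
  obtain ⟨V, hV, hVv, hVp⟩ := exists_isSmoothField_vertical hF (hsurj p) hv
  exact ⟨V, hV, hVv, by rw [hVp]; rfl⟩

variable [IsContMDiffRiemannianBundle 𝓘(ℝ, E) ∞ E (fun x : M => TangentSpace 𝓘(ℝ, E) x)]

/-- `𝒯_V φW = 0` for vertical `V`, `W` says exactly that the fibres are totally geodesic. -/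
theorem isTotallyGeodesic_vertical_iff (hF : ContMDiff 𝓘(ℝ, E) 𝓘(ℝ, E') ∞ F)
    (hsurj : ∀ x, Function.Surjective (mfderiv 𝓘(ℝ, E) 𝓘(ℝ, E') F x))
    (hφ : ∀ x, (vertical E E' F x).map (S.φ x).toLinearMap = horizontal E E' F x) :
    IsTotallyGeodesic (vertical E E' F) (horizontal E E' F) ↔
      ∀ V W : Π x : M, TangentSpace 𝓘(ℝ, E) x, IsSmoothField V → IsSmoothField W →
        (∀ x, V x ∈ vertical E E' F x) → (∀ x, W x ∈ vertical E E' F x) →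
        tensorT E E' F V (applyField S.φ W) = 0 := by
  constructor
  · intro h V W hV hW hVv hWv
    have hφW : ∀ x, applyField S.φ W x ∈ horizontal E E' F x := fun x =>
      φ_mem_horizontal hφ (hWv x)
    rw [tensorT_eq_zero_iff hVv hφW]
    intro p u hu
    obtain ⟨U, hU, hUv, rfl⟩ := exists_isSmoothField_vertical hF (hsurj p) hu
    have hφWd := (hW.applyField_φ S).mdiffAt p
    have h1 := h p (V p) U _ (hVv p) (hU.mdiffAt p) hφWd (.of_forall hUv) (.of_forall hφW)
    rw [inner_leviCivita_eq_neg _ (hU.mdiffAt p) hφWd (.of_forall fun x =>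
      inner_eq_zero_of_mem_horizontal (hUv x) (hφW x))] at h1
    exact neg_eq_zero.1 h1
  · intro h p v Y Z hv hY hZ hYv hZh
    obtain ⟨V, hV, hVv, rfl⟩ := exists_isSmoothField_vertical hF (hsurj p) hv
    obtain ⟨W, hW, hWv, hWp⟩ :=
      exists_isSmoothField_horizontal hF hsurj hφ hZh.self_of_nhds
    have hφW : ∀ x, applyField S.φ W x ∈ horizontal E E' F x := fun x =>
      φ_mem_horizontal hφ (hWv x)
    rw [← hWp]
    refine (inner_leviCivita_eq_neg _ hY ((hW.applyField_φ S).mdiffAt p)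
      (hYv.mono fun x hx => inner_eq_zero_of_mem_horizontal hx (hφW x))).trans ?_
    rw [(tensorT_eq_zero_iff hVv hφW).1 (h V W hV hW hVv hWv) p _ hYv.self_of_nhds, neg_zero]

/-- `𝒜_X φY = 0` for horizontal `X`, `Y` says exactly that the horizontal distribution is totally
geodesic: the fields `φ Y` span the orthogonal complement of `ξ` in the vertical distribution, and
`g(∇_X Y, ξ) = -g(Y, ∇_X ξ) = 0` holds in any case. -/
theorem isTotallyGeodesic_horizontal_iff (hS : S.IsCosymplectic)
    (hF : ContMDiff 𝓘(ℝ, E) 𝓘(ℝ, E') ∞ F)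
    (hsurj : ∀ x, Function.Surjective (mfderiv 𝓘(ℝ, E) 𝓘(ℝ, E') F x))
    (hφ : ∀ x, (vertical E E' F x).map (S.φ x).toLinearMap = horizontal E E' F x) :
    IsTotallyGeodesic (horizontal E E' F) (vertical E E' F) ↔
      ∀ X Y : Π x : M, TangentSpace 𝓘(ℝ, E) x, IsSmoothField X → IsSmoothField Y →
        (∀ x, X x ∈ horizontal E E' F x) → (∀ x, Y x ∈ horizontal E E' F x) →
        tensorA E E' F X (applyField S.φ Y) = 0 := by
  have hφh : ∀ {V : Π x : M, TangentSpace 𝓘(ℝ, E) x}, (∀ x, V x ∈ vertical E E' F x) →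
      ∀ x, applyField S.φ V x ∈ horizontal E E' F x := fun hV x => φ_mem_horizontal hφ (hV x)
  have hφv : ∀ {X : Π x : M, TangentSpace 𝓘(ℝ, E) x}, (∀ x, X x ∈ horizontal E E' F x) →
      ∀ x, applyField S.φ X x ∈ vertical E E' F x := fun hX x => φ_mem_vertical hS.metric hφ (hX x)
  have horth : ∀ {x : M} {v w : TangentSpace 𝓘(ℝ, E) x}, v ∈ horizontal E E' F x →
      w ∈ vertical E E' F x → (inner ℝ v w : ℝ) = 0 := fun hv hw =>
    (real_inner_comm _ _).trans (inner_eq_zero_of_mem_horizontal hw hv)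
  constructor
  · intro h X Y hX hY hXh hYh
    rw [tensorA_eq_zero_iff hXh (hφv hYh)]
    intro p u hu
    obtain ⟨U, hU, hUv, rfl⟩ := exists_isSmoothField_horizontal hF hsurj hφ hu
    have hφU := (hU.applyField_φ S).mdiffAt p
    have hφY := (hY.applyField_φ S).mdiffAt p
    have h1 := h p (X p) _ _ (hXh p) hφU hφY (.of_forall (hφh hUv)) (.of_forall (hφv hYh))
    rw [inner_leviCivita_eq_neg _ hφU hφY (.of_forall fun x =>
      horth (hφh hUv x) (hφv hYh x))] at h1
    exact neg_eq_zero.1 h1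
  · intro h p v Y Z hv hY hZ hYh hZv
    obtain ⟨U, hU, hUv, rfl⟩ := exists_isSmoothField_horizontal hF hsurj hφ hv
    have hX := hU.applyField_φ S
    have hXh := hφh hUv
    obtain ⟨B, hB, hBv, hBp⟩ := exists_isSmoothField_vertical hF (hsurj p) hZv.self_of_nhds
    have hφB := hB.applyField_φ S
    -- `Z = -φ(φ Z) + η(Z) ξ` at `p`
    have hZp : Z p = -S.φ p (applyField S.φ B p) + S.η p (Z p) • S.ξ p := by
      rw [applyField, hBp, S.φ_φ]
      simp
    have h1 := inner_leviCivita_eq_neg (applyField S.φ U p) hY ((hφB.applyField_φ S).mdiffAt p)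
      (hYh.mono fun x hx => horth hx (hφv (hφh hBv) x))
    rw [(tensorA_eq_zero_iff hXh (hφv (hφh hBv))).1 (h _ _ hX hφB hXh (hφh hBv)) p _
      hYh.self_of_nhds, neg_zero] at h1
    have h2 := inner_leviCivita_eq_neg (applyField S.φ U p) hY (S.smooth_ξ.mdiffAt p)
      (hYh.mono fun x hx => horth hx (ξ_mem_vertical hS.metric hφ x))
    obtain ⟨C, hC, hCv, hCp⟩ := exists_isSmoothField_horizontal hF hsurj hφ hYh.self_of_nhds
    have h3 := hS.inner_leviCivita_ξ hX hC
      (fun x => η_eq_zero_of_mem_horizontal hφ (hXh x)) p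
    rw [hCp] at h3
    rw [(real_inner_comm _ _).trans h3, neg_zero] at h2
    simp only [applyField] at hZp h1 h2
    rw [hZp, inner_add_right, inner_neg_right, inner_smul_right, h1, h2, neg_zero, mul_zero,
      add_zero]

end Lagrangian

end RiemGeom

theorem theorem9
    {E : Type*} [NormedAddCommGroup E] [NormedSpace ℝ E] [FiniteDimensional ℝ E]
    {M : Type*} [TopologicalSpace M] [T2Space M] [SecondCountableTopology M]
    [ChartedSpace E M] [IsManifold 𝓘(ℝ, E) ∞ M]
    [RiemannianBundle (fun x : M => TangentSpace 𝓘(ℝ, E) x)]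
    [IsContMDiffRiemannianBundle 𝓘(ℝ, E) ∞ E (fun x : M => TangentSpace 𝓘(ℝ, E) x)]
    {E' : Type*} [NormedAddCommGroup E'] [NormedSpace ℝ E'] [FiniteDimensional ℝ E']
    {N : Type*} [TopologicalSpace N] [T2Space N] [SecondCountableTopology N]
    [ChartedSpace E' N] [IsManifold 𝓘(ℝ, E') ∞ N]
    [RiemannianBundle (fun y : N => TangentSpace 𝓘(ℝ, E') y)]
    [IsContMDiffRiemannianBundle 𝓘(ℝ, E') ∞ E' (fun y : N => TangentSpace 𝓘(ℝ, E') y)]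
    (m : ℕ) (hdim : Module.finrank ℝ E = 2 * m + 1)
    (S : RiemGeom.AlmostContactStructure E M) (hS : S.IsCosymplectic)
    (F : M → N) (hF : RiemGeom.IsAntiInvariantSubmersion (E' := E') S F)
    (hφ : ∀ x, Submodule.map (S.φ x).toLinearMap (RiemGeom.vertical E E' F x)
      = RiemGeom.horizontal E E' F x) :
    RiemGeom.IsLocallyRiemannianProduct
        (RiemGeom.vertical E E' F) (RiemGeom.horizontal E E' F) ↔
      (∀ X Y : Π x : M, TangentSpace 𝓘(ℝ, E) x,
        RiemGeom.IsSmoothField X → RiemGeom.IsSmoothField Y →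
        (∀ x, X x ∈ RiemGeom.horizontal E E' F x) →
        (∀ x, Y x ∈ RiemGeom.horizontal E E' F x) →
        RiemGeom.tensorA E E' F X (RiemGeom.applyField S.φ Y) = 0) ∧
      (∀ V W : Π x : M, TangentSpace 𝓘(ℝ, E) x,
        RiemGeom.IsSmoothField V → RiemGeom.IsSmoothField W →
        (∀ x, V x ∈ RiemGeom.vertical E E' F x) →
        (∀ x, W x ∈ RiemGeom.vertical E E' F x) →
        RiemGeom.tensorT E E' F V (RiemGeom.applyField S.φ W) = 0) := by
  have horth : ∀ x, RiemGeom.vertical E E' F x ⟂ RiemGeom.horizontal E E' F x := fun x =>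
    Submodule.isOrtho_orthogonal_right _
  rw [← RiemGeom.isTotallyGeodesic_horizontal_iff hS hF.smooth hF.maximal_rank hφ,
    ← RiemGeom.isTotallyGeodesic_vertical_iff hF.smooth hF.maximal_rank hφ]
  exact ⟨fun h => (h.isTotallyGeodesic horth).symm, fun h =>
    RiemGeom.isLocallyRiemannianProduct_of_isTotallyGeodesic horth h.2 h.1
      (RiemGeom.exists_param_of_isTotallyGeodesic_horizontal hF.smooth hF.maximal_rank h.1)⟩

end
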